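/- Let $\mathbb X$ be an infinite-dimensional separable Banach space over $\mathbb K=\mathbb R$ or $\mathbb C$, and let $\mathcal B=(\mathbf x_i)_{i\in\mathbb N}$ be a Markushevich basis of $\mathbb X$ with dual basis $(\mathbf x_i^*)_{i\in\mathbb N}\subset\mathbb X^*$; that is, $[\mathbf x_i:i\in\mathbb N]$ is dense in $\mathbb X$, $\mathbf x_i^*(\mathbf x_j)=\delta_{i,j}$, and $[\mathbf x_i^*:i\in\mathbb N]$ is weak-star dense in $\mathbb X^*$. Assume $\lambda:=\sup_i\|\mathbf x_i\|<\infty$ and $\lambda':=\sup_i\|\mathbf x_i^*\|<\infty$. Notation. Put $\operatorname{supp}(x)=\{i:\mathbf x_i^*(x)\ne0\}$ and, for finite $A\subset\mathbb N$, $P_A(x)=\sum_{i\in A}\mathbf x_i^*(x)\mathbf x_i$ and $\mathbf 1_{\varepsilon,A}=\sum_{i\in A}\varepsilon_i\mathbf x_i$ for scalars $|\varepsilon_i|=1$. A weight $\mathbf w=(w_i)_{i\in\mathbb N}$ is a sequence of positive numbers, and $w(A)=\sum_{i\in A}w_i\in[0,\infty]$ for $A\subset\mathbb N$. For $m\ge1$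 and $0<t\le1$, $\mathcal G(x,m,t)$ is the family of all $A\subset\mathbb N$ with $|A|=m$ and $|\mathbf x_i^*(x)|\ge t|\mathbf x_j^*(x)|$ for all $i\in A$, $j\notin A$; $\Lambda_m(x)$ is the member of $\mathcal G(x,m,1)$ such that $\max(\Lambda_m(x)\setminus B)<\min(B\setminus\Lambda_m(x))$ for every other $B\in\mathcal G(x,m,1)$. Let $\mathbf C>0$, $0<s\le1$, and suppose that $\mathcal B$ is $\mathbf C$-$s$-$\mathbf w$-semi-greedy: for every $x\in\mathbb X$ and $m\ge1$ there are $A\in\mathcal G(x,m,s)$ and $y\in\mathbb X$ with $\operatorname{supp}(y)\subset A$ such that $\|x-y\|\le\mathbf C\|x-z\|$ for all $z\in\mathbb X$ with finite support and $w(\operatorname{supp}(z))\le w(A)$. Suppose also that $\mathbf w$ has a subsequence $(w_{i_k})_{k}$ with $\inf_kw_{i_k}>0$. Let $\mathbf M=\mathbf M_{fs}((\mathbf x_{i_k})_k,\mathbb X)$ be the finite dimensional separation constant of $(\mathbf x_{i_k})_k$, i.e. the minimum of the numbers $M>0$ with the following property, where $u_k=\mathbf x_{i_k}$ (part of the assertion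 is that this minimum exists): for every separable subspace $\mathbb Z\subset\mathbb X$ and every $\epsilon>0$ there is a basic subsequence $(u_{k_l})_l$ with basis constant at most $M+\epsilon$ such that for every finite dimensional subspace $\mathbb F\subset\mathbb Z$ there is $j\in\mathbb N$ with $\|x\|\le(M+\epsilon)\|x+z\|$ for all $x\in\mathbb F$ and all $z\in\overline{[u_{k_l}:l>j]}$. Then the following hold. (i) For all $x\in\mathbb X$, $m\ge1$, $0<t\le1$, $A\in\mathcal G(x,m,t)$ and all $y\in\mathbb X$ with $w(\operatorname{supp}(y))\le w(A)$ and $\operatorname{supp}(y)\cap A=\emptyset$, $$\|x-P_A(x)\|\le\mathbf C\mathbf M\max\{1+8t^{-1}s^{-1}\lambda\lambda',\,1+6\mathbf Ct^{-1}s^{-3}\}\,\|x-y\|.$$ Moreover, $\mathcal B$ is $\mathbf w$-almost greedy with constant $K_1=\mathbf C\mathbf M\max\{1+8s^{-1}\lambda\lambda',1+6\mathbf Cs^{-3}\}$: for all $x\in\mathbb X$ and $m\ge1$, $\|x-P_{\Lambda_m(x)}(x)\|\le K_1\|x-P_B(x)\|$ for every finite $B\subset\mathbb N$ with $w(B)\le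 w(\Lambda_m(x))$. (ii) Let $K_2=2s^{-1}\mathbf C\mathbf M\max\{\lambda\lambda',2s^{-2}\mathbf C\}$. For every $x\in\mathbb X$, every finite $A\subset\mathbb N$ and all scalars $|\varepsilon_i|=1$ $(i\in A)$, if $w(A)\le w(\{i\in\mathbb N:|\mathbf x_i^*(x)|\ge1\})$, then $\|\mathbf 1_{\varepsilon,A}\|\le K_2\|x\|$. Consequently, $\mathcal B$ is $\mathbf w$-superdemocratic with constant $K_2$ ($\|\mathbf 1_{\varepsilon,A}\|\le K_2\|\mathbf 1_{\varepsilon',B}\|$ for all finite $A,B$ with $w(A)\le w(B)$ and all unimodular $\varepsilon,\varepsilon'$) and truncation quasi-greedy with constant $K_2$ ($\min_{i\in A}|\mathbf x_i^*(x)|\,\|\sum_{i\in A}\operatorname{sgn}(\mathbf x_i^*(x))\mathbf x_i\|\le K_2\|x\|$ for all $x$ and all finite nonempty $A$, where $\operatorname{sgn}(a)=a/|a|$ for $a\ne0$ and $\operatorname{sgn}(0)=1$); in fact the last inequality holds with arbitrary unimodular scalars $\varepsilon_i$ in place of the signs (Property (C)). -/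

import Mathlib

open scoped ENNReal

namespace WeightedGreedy

noncomputable section

section Bases

variable (𝕜 : Type*) [RCLike 𝕜] {X : Type*} [NormedAddCommGroup X] [NormedSpace 𝕜 X]

/-- `x` is a Markushevich basis of `X` with biorthogonal functionals `xs`: `x` is fundamental,
`xs` is biorthogonal to `x`, and `xs` is total (its span is weak-star dense in the dual). -/
structure IsMarkushevichBasis (x : ℕ → X) (xs : ℕ → StrongDual 𝕜 X) : Prop where
  fundamental : (Submodule.span 𝕜 (Set.range x)).topologicalClosure = ⊤
  biorthogonal : ∀ i j, xs i (x j) = if i = j then 1 else 0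
  total : Dense (Submodule.span 𝕜 (Set.range fun i => StrongDual.toWeakDual (xs i)) :
    Set (WeakDual 𝕜 X))

/-- `u` is a basic sequence with basis constant at most `K`: it is a Schauder basis of the closure
of its span, and the partial sum projections there have norm at most `K`. -/
def IsBasicWith (u : ℕ → X) (K : ℝ) : Prop :=
  ∃ b : SchauderBasis 𝕜 (Submodule.span 𝕜 (Set.range u)).topologicalClosure,
    (∀ k, (b.basis k : X) = u k) ∧ ∀ n, ‖b.proj n‖ ≤ K

/-- `u` has the finite dimensional separation property with constant `M`. -/
def HasFDSPWith (u : ℕ → X) (M : ℝ) : Prop :=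
  0 < M ∧ ∀ Z : Submodule 𝕜 X, TopologicalSpace.IsSeparable (Z : Set X) → ∀ ε : ℝ, 0 < ε →
    ∃ φ : ℕ → ℕ, StrictMono φ ∧ IsBasicWith 𝕜 (u ∘ φ) (M + ε) ∧
      ∀ F : Submodule 𝕜 X, F ≤ Z → FiniteDimensional 𝕜 F →
        ∃ j : ℕ, ∀ y ∈ F,
          ∀ z ∈ (Submodule.span 𝕜 ((u ∘ φ) '' Set.Ioi j)).topologicalClosure,
            ‖y‖ ≤ (M + ε) * ‖y + z‖

/-- The finite dimensional separation constant of `u`. -/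
def fdsConstant (u : ℕ → X) : ℝ := sInf {M | HasFDSPWith 𝕜 u M}

end Bases

/-- The `w`-measure `w(A) = ∑_{i ∈ A} w i` of a set of indices, possibly infinite. -/
def wMeasure (w : ℕ → ℝ) (A : Set ℕ) : ℝ≥0∞ := ∑' i : A, ENNReal.ofReal (w i)

variable {𝕜 : Type*} [RCLike 𝕜] {X : Type*} [NormedAddCommGroup X] [NormedSpace 𝕜 X]

/-- The support of `y` with respect to the coordinate functionals `xs`. -/
def supp (xs : ℕ → StrongDual 𝕜 X) (y : X) : Set ℕ := {i | xs i y ≠ 0}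

/-- The projection `P_A y = ∑_{i ∈ A} xs i y • x i`. -/
def proj (x : ℕ → X) (xs : ℕ → StrongDual 𝕜 X) (A : Finset ℕ) (y : X) : X :=
  ∑ i ∈ A, xs i y • x i

/-- `A` is an `m`-`t`-greedy set for `y`. -/
def IsGreedySet (xs : ℕ → StrongDual 𝕜 X) (y : X) (m : ℕ) (t : ℝ) (A : Finset ℕ) : Prop :=
  A.card = m ∧ ∀ i ∈ A, ∀ j ∉ A, t * ‖xs j y‖ ≤ ‖xs i y‖

/-- `A` is the distinguished greedy set `Λ_m(y)`: the `m`-`1`-greedy set that takes the smallest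
indices among ties. (There is exactly one such set when `xs j y` tends to zero.) -/
def IsLambda (xs : ℕ → StrongDual 𝕜 X) (y : X) (m : ℕ) (A : Finset ℕ) : Prop :=
  IsGreedySet xs y m 1 A ∧
    ∀ B, IsGreedySet xs y m 1 B → ∀ i ∈ A \ B, ∀ j ∈ B \ A, i < j

/-- Weak weight-semi-greedy with parameter `s`, weight `w` and constant `C`. -/
def IsWeakSemiGreedy (xs : ℕ → StrongDual 𝕜 X) (w : ℕ → ℝ) (s C : ℝ) : Prop :=
  ∀ v : X, ∀ m : ℕ, 1 ≤ m →
    ∃ A : Finset ℕ, IsGreedySet xs v m s A ∧ ∃ y : X, supp xs y ⊆ (A : Set ℕ) ∧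
      ∀ z : X, (supp xs z).Finite → wMeasure w (supp xs z) ≤ wMeasure w A →
        ‖v - y‖ ≤ C * ‖v - z‖

/-- Weight-almost greedy with weight `w` and constant `K`. -/
def IsAlmostGreedy (x : ℕ → X) (xs : ℕ → StrongDual 𝕜 X) (w : ℕ → ℝ) (K : ℝ) : Prop :=
  ∀ v : X, ∀ m : ℕ, 1 ≤ m →
    ∃ A : Finset ℕ, IsLambda xs v m A ∧
      ∀ B : Finset ℕ, wMeasure w B ≤ wMeasure w A →
        ‖v - proj x xs A v‖ ≤ K * ‖v - proj x xs B v‖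

variable (𝕜) in
/-- Weight-superdemocratic with weight `w` and constant `K`. -/
def IsSuperdemocratic (x : ℕ → X) (w : ℕ → ℝ) (K : ℝ) : Prop :=
  ∀ A B : Finset ℕ, wMeasure w A ≤ wMeasure w B →
    ∀ ε ε' : ℕ → 𝕜, (∀ i ∈ A, ‖ε i‖ = 1) → (∀ i ∈ B, ‖ε' i‖ = 1) →
      ‖∑ i ∈ A, ε i • x i‖ ≤ K * ‖∑ i ∈ B, ε' i • x i‖

/-- Property (C) with constant `K`. -/
def HasPropertyC (x : ℕ → X) (xs : ℕ → StrongDual 𝕜 X) (K : ℝ) : Prop :=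
  ∀ v : X, ∀ A : Finset ℕ, ∀ hA : A.Nonempty, ∀ ε : ℕ → 𝕜, (∀ i ∈ A, ‖ε i‖ = 1) →
    A.inf' hA (fun i => ‖xs i v‖) * ‖∑ i ∈ A, ε i • x i‖ ≤ K * ‖v‖

open Classical in
/-- The sign of a scalar, with the convention that the sign of `0` is `1`. -/
def sgn (a : 𝕜) : 𝕜 := if a = 0 then 1 else a / (‖a‖ : 𝕜)

/-- Truncation quasi-greedy with constant `K`. -/
def IsTruncationQuasiGreedy (x : ℕ → X) (xs : ℕ → StrongDual 𝕜 X) (K : ℝ) : Prop :=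
  ∀ v : X, ∀ A : Finset ℕ, ∀ hA : A.Nonempty,
    A.inf' hA (fun i => ‖xs i v‖) * ‖∑ i ∈ A, sgn (xs i v) • x i‖ ≤ K * ‖v‖

end

end WeightedGreedy

/-! Two tests of the semi-greedy inequality carry everything; both use blocks of indices far out in
a set `T` of the chosen subsequence, where weights are bounded below and far spans are separated
from each fixed vector with constant close to `M`.

Test 1 (`exists_norm_le_of_far`): add to `v` a far block sum `b` with coefficient `τ` so large that
the block is the only weak greedy set of its size. The approximant then lives on the block, so
separation removes it together with `τ • b`, and `‖v‖ ≤ M * C * ‖v + τ • b - z‖` for every finitely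
supported `z` of weight at most that of the block. Choosing `z = v` bounds unimodular sums, and
choosing `z = y - P_A v` (with `v - P_A v` in place of `v`) bounds greedy remainders, provided `b`
can be chosen with small norm.

Test 2 (`exists_approx`, `exists_far_unimodular`) supplies such `b`. Add to `g` a far block with
coefficients so small that weak greedy sets avoid it. The approximants then live in one finite
dimensional space and are bounded, hence two of them nearly coincide for disjoint blocks.
Subtracting cancels `g` and the approximants, leaving a signed sum over both blocks with norm
controlled by `‖g‖`.

The separation constant exists by a Mazur construction in the bidual. Competitors `y` of infinite
support are reached at the end: superdemocracy and finite weight make `y` the limit of its partial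
sums. -/

namespace WeightedGreedy

open Filter Topology

/-! ### Almost orthogonality and Mazur's construction in a dual space -/

section Separation

variable {𝕜 : Type*} [RCLike 𝕜] {X : Type*} [NormedAddCommGroup X] [NormedSpace 𝕜 X]

/-- The functionals vanishing at `y` form a weak-star closed set containing a weak-star dense span.
-/
theorem IsMarkushevichBasis.eq_zero {x : ℕ → X} {xs : ℕ → StrongDual 𝕜 X}
    (h : IsMarkushevichBasis 𝕜 x xs) {y : X} (hy : ∀ i, xs i y = 0) : y = 0 := by
  have key : ∀ f : WeakDual 𝕜 X, f y = 0 := by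
    have hcl : IsClosed {f : WeakDual 𝕜 X | f y = 0} :=
      isClosed_singleton.preimage (WeakDual.eval_continuous y)
    have hsub : (Submodule.span 𝕜 (Set.range fun i => StrongDual.toWeakDual (xs i)) :
        Set (WeakDual 𝕜 X)) ⊆ {f : WeakDual 𝕜 X | f y = 0} := by
      intro f hf
      induction hf using Submodule.span_induction with
      | mem f hf => obtain ⟨i, rfl⟩ := hf; exact hy i
      | zero => rfl
      | add f g _ _ hf hg =>
        rw [Set.mem_ofPred_eq] at hf hg
        change f y + g y = 0
        rw [hf, hg, add_zero]
      | smul a f _ hf =>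
        rw [Set.mem_ofPred_eq] at hf
        change a • f y = 0
        rw [hf, smul_zero]
    intro f
    have := hcl.closure_subset_iff.2 hsub
    rw [h.total.closure_eq] at this
    exact this (Set.mem_univ f)
  have := NormedSpace.norm_le_dual_bound 𝕜 y le_rfl (fun f => by
    have := key (StrongDual.toWeakDual f)
    rw [StrongDual.toWeakDual_apply] at this
    simp [this])
  exact norm_le_zero_iff.1 this

/-- Finitely many unit vectors almost norm a finite dimensional subspace of the dual. -/
theorem exists_finset_norming (G : Submodule 𝕜 (StrongDual 𝕜 X)) [FiniteDimensional 𝕜 G] {r : ℝ}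
    (hr : r < 1) : ∃ Φ : Finset X, (∀ f ∈ Φ, ‖f‖ ≤ 1) ∧ ∀ y ∈ G, ‖y‖ = 1 → ∃ f ∈ Φ, r < ‖y f‖ := by
  have hcomp : IsCompact (Subtype.val '' Metric.sphere (0 : G) 1) := by
    have : ProperSpace G := FiniteDimensional.proper 𝕜 G
    exact (isCompact_sphere _ _).image continuous_subtype_val
  have hex : ∀ y ∈ Subtype.val '' Metric.sphere (0 : G) 1, ∃ f : X, ‖f‖ ≤ 1 ∧ r < ‖y f‖ := by
    rintro _ ⟨y, hy, rfl⟩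
    have hy1 : r < ‖(y : StrongDual 𝕜 X)‖ := by
      have : ‖(y : StrongDual 𝕜 X)‖ = 1 := mem_sphere_zero_iff_norm.1 hy
      rwa [this]
    obtain ⟨f, hf, hf'⟩ := ContinuousLinearMap.exists_lt_apply_of_lt_opNorm _ hy1
    exact ⟨f, hf.le, hf'⟩
  obtain ⟨t, ht⟩ := hcomp.elim_finite_subcover
    (fun f : Metric.closedBall (0 : X) 1 => {y : StrongDual 𝕜 X | r < ‖y f‖})
    (fun f => isOpen_lt continuous_const (by fun_prop)) (by
      intro y hy
      obtain ⟨f, hf, hf'⟩ := hex y hy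
      exact Set.mem_iUnion.2 ⟨⟨f, by simpa using hf⟩, hf'⟩)
  classical
  refine ⟨t.image Subtype.val, ?_, fun y hy hy1 => ?_⟩
  · intro f hf
    obtain ⟨g, -, rfl⟩ := Finset.mem_image.1 hf
    exact mem_closedBall_zero_iff.1 g.2
  · have := ht ⟨⟨y, hy⟩, mem_sphere_zero_iff_norm.2 hy1, rfl⟩
    simp only [Set.mem_iUnion] at this
    obtain ⟨f, hf, hf'⟩ := this
    exact ⟨f, Finset.mem_image_of_mem _ hf, hf'⟩

/-- Members of a weak-star null family that is bounded away from zero are eventually almost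
orthogonal to a given finite dimensional subspace. -/
theorem eventually_norm_le_norm_add_smul {ι : Type*} {l : Filter ι} {v : ι → StrongDual 𝕜 X}
    {d : ℝ} (hd : 0 < d) (hv : ∀ i, d ≤ ‖v i‖) (hlim : ∀ f, Tendsto (fun i => v i f) l (𝓝 0))
    (G : Submodule 𝕜 (StrongDual 𝕜 X)) [FiniteDimensional 𝕜 G] {θ : ℝ} (hθ : 1 < θ) :
    ∀ᶠ i in l, ∀ y ∈ G, ∀ a : 𝕜, ‖y‖ ≤ θ * ‖y + a • v i‖ := by
  have hθ' : θ⁻¹ < 1 := inv_lt_one_of_one_lt₀ hθ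
  have hθ0 : 0 < θ := by linarith
  obtain ⟨Φ, hΦ, hG⟩ := exists_finset_norming G (r := (1 + θ⁻¹) / 2) (by linarith)
  have hη : 0 < (1 - θ⁻¹) / 2 * (d / 2) := by
    have : 0 < 1 - θ⁻¹ := by linarith
    positivity
  have hev : ∀ᶠ i in l, ∀ f ∈ Φ, ‖v i f‖ < (1 - θ⁻¹) / 2 * (d / 2) := by
    rw [Filter.eventually_all_finset]
    intro f _
    have := (hlim f).norm
    rw [norm_zero] at this
    exact this.eventually_lt_const hη
  filter_upwards [hev] with i hi
  have unit : ∀ y ∈ G, ‖y‖ = 1 → ∀ a : 𝕜, θ⁻¹ ≤ ‖y + a • v i‖ := by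
    intro y hy hy1 a
    -- For small `a` a norming vector hardly sees `v i`; for large `a` the term `a • v i` has norm
    -- at least 2 and dominates the unit vector `y`.
    by_cases ha : ‖a‖ ≤ 2 / d
    · obtain ⟨f, hf, hf'⟩ := hG y hy hy1
      have h1 : ‖(y + a • v i) f‖ ≤ ‖y + a • v i‖ := (y + a • v i).unit_le_opNorm f (hΦ f hf)
      have h2 : ‖y f‖ - ‖a‖ * ‖v i f‖ ≤ ‖(y + a • v i) f‖ := by
        have := norm_sub_le (y f + a • v i f) (a • v i f)
        rw [add_sub_cancel_right, norm_smul] at this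
        simp only [add_apply, smul_apply]
        linarith
      have h3 : ‖a‖ * ‖v i f‖ ≤ 2 / d * ((1 - θ⁻¹) / 2 * (d / 2)) :=
        mul_le_mul ha (hi f hf).le (norm_nonneg _) (by positivity)
      have h4 : 2 / d * ((1 - θ⁻¹) / 2 * (d / 2)) = (1 - θ⁻¹) / 2 := by field_simp
      linarith
    · push Not at ha
      have h1 : 2 ≤ ‖a • v i‖ := by
        rw [norm_smul]
        calc (2 : ℝ) = 2 / d * d := by field_simp
          _ ≤ ‖a‖ * ‖v i‖ := mul_le_mul ha.le (hv i) hd.le (norm_nonneg _)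
      have h2 := norm_sub_le (y + a • v i) y
      rw [add_sub_cancel_left, hy1] at h2
      linarith
  intro y hy a
  rcases eq_or_ne y 0 with rfl | hy0
  · rw [norm_zero]; positivity
  have hn : ‖y‖ ≠ 0 := norm_ne_zero_iff.2 hy0
  have h := unit (((‖y‖ : ℝ) : 𝕜)⁻¹ • y) (G.smul_mem _ hy) (by simp [norm_smul, hn])
    (((‖y‖ : ℝ) : 𝕜)⁻¹ * a)
  have hfac : ((‖y‖ : ℝ) : 𝕜)⁻¹ • y + (((‖y‖ : ℝ) : 𝕜)⁻¹ * a) • v i =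
      ((‖y‖ : ℝ) : 𝕜)⁻¹ • (y + a • v i) := by module
  rw [hfac, norm_smul, norm_inv, RCLike.norm_ofReal, abs_norm,
    inv_mul_eq_div, le_div_iff₀ (norm_pos_iff.2 hy0), inv_mul_le_iff₀ hθ0] at h
  exact h

theorem exists_eq_sum_Ico_of_mem_span {u : ℕ → X} {n : ℕ} {z : X}
    (hz : z ∈ Submodule.span 𝕜 (u '' Set.Ici n)) :
    ∃ (a : ℕ → 𝕜) (m : ℕ), z = ∑ i ∈ Finset.Ico n m, a i • u i := by
  obtain ⟨l, hl, rfl⟩ := (Finsupp.mem_span_image_iff_linearCombination 𝕜).1 hz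
  refine ⟨l, l.support.sup id + 1, ?_⟩
  rw [Finsupp.linearCombination_apply, Finsupp.sum]
  refine Finset.sum_subset (fun i hi => ?_) (fun i _ hi => ?_)
  · rw [Finset.mem_Ico]
    exact ⟨hl hi, Nat.lt_succ_of_le (Finset.le_sup (f := id) hi)⟩
  · rw [Finsupp.notMem_support_iff.1 hi, zero_smul]

/-- A Mazur type construction in a dual space. -/
theorem exists_strictMono_norm_le {v : ℕ → StrongDual 𝕜 X} {l : Filter ℕ} [l.NeBot]
    (hl : l ≤ atTop) {d : ℝ} (hd : 0 < d) (hv : ∀ i, d ≤ ‖v i‖)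
    (hlim : ∀ f, Tendsto (fun i => v i f) l (𝓝 0))
    (G : ℕ → Submodule 𝕜 (StrongDual 𝕜 X)) [∀ n, FiniteDimensional 𝕜 (G n)] (hG : Monotone G)
    (hvG : ∀ n, v n ∈ G (n + 1)) :
    ∃ φ : ℕ → ℕ, StrictMono φ ∧ ∃ N : ℕ → ℕ, (∀ n, n ≤ N n) ∧ (∀ i n, i < n → φ i < N n) ∧
      ∀ n, ∀ y ∈ G (N n), ∀ (a : ℕ → 𝕜) (m : ℕ),
        ‖y‖ ≤ 2 * ‖y + ∑ i ∈ Finset.Ico n m, a i • v (φ i)‖ := by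
  -- Step `n` may lose the factor `c (n + 1) / c n > 1`. These telescope to `c m / c n`, which is at
  -- most 2 because `c` takes values in `[1, 2]`.
  set c : ℕ → ℝ := fun n => 2 - 1 / ((n : ℝ) + 1) with hc
  have hc1 : ∀ n, 1 ≤ c n := fun n => by
    have : 1 / ((n : ℝ) + 1) ≤ 1 := by
      rw [div_le_one (by positivity)]; linarith [Nat.cast_nonneg (α := ℝ) n]
    simp only [hc]; linarith
  have hc2 : ∀ n, c n ≤ 2 := fun n => by
    have : 0 ≤ 1 / ((n : ℝ) + 1) := by positivity
    simp only [hc]; linarith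
  have hcc : ∀ n, c n < c (n + 1) := fun n => by
    have : 1 / (((n + 1 : ℕ) : ℝ) + 1) < 1 / ((n : ℝ) + 1) :=
      one_div_lt_one_div_of_lt (by positivity) (by push_cast; linarith)
    simp only [hc]; linarith
  have hstep : ∀ n N : ℕ, ∃ k, N ≤ k ∧
      ∀ y ∈ G N, ∀ a : 𝕜, ‖y‖ ≤ c (n + 1) / c n * ‖y + a • v k‖ := fun n N =>
    (Filter.Eventually.and (hl (eventually_ge_atTop N))
      (eventually_norm_le_norm_add_smul hd hv hlim (G N)
      ((one_lt_div (by linarith [hc1 n])).2 (hcc n)))).exists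
  choose k hkN hk using hstep
  -- The `+ 1` puts the vector just selected into `G (N (n + 1))`, so the next choice is almost
  -- orthogonal to it as well.
  let N : ℕ → ℕ := fun n => Nat.rec 0 (fun n N => k n N + 1) n
  have hN : ∀ n, N (n + 1) = k n (N n) + 1 := fun n => rfl
  have hNlt : ∀ n, N n ≤ k n (N n) := fun n => hkN _ _
  have hNmono : StrictMono N := strictMono_nat_of_lt_succ fun n => by
    rw [hN]; exact Nat.lt_succ_of_le (hNlt n)
  have hlt : ∀ i n, i < n → k i (N i) < N n := fun i n h => by
    have := hNmono.monotone (Nat.succ_le_of_lt h)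
    rw [hN] at this
    omega
  refine ⟨fun n => k n (N n), fun i n h => (hlt i n h).trans_le (hNlt n), N, hNmono.id_le, hlt,
    fun n y hy a m => ?_⟩
  have main : ∀ m, n ≤ m → y + ∑ i ∈ Finset.Ico n m, a i • v (k i (N i)) ∈ G (N m) ∧
      ‖y‖ ≤ c m / c n * ‖y + ∑ i ∈ Finset.Ico n m, a i • v (k i (N i))‖ := by
    intro m hm
    induction m, hm using Nat.le_induction with
    | base => simp [hy, div_self (show c n ≠ 0 by linarith [hc1 n])]
    | succ m hm ih =>
      rw [Finset.sum_Ico_succ_top hm, ← add_assoc]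
      refine ⟨add_mem (hG (hNmono.monotone (Nat.le_succ m)) ih.1)
        (Submodule.smul_mem _ _ (hN m ▸ hvG _)), ih.2.trans ?_⟩
      have h1 := hk m (N m) _ ih.1 (a m)
      have h2 : 0 ≤ c m / c n := div_nonneg (by linarith [hc1 m]) (by linarith [hc1 n])
      refine (mul_le_mul_of_nonneg_left h1 h2).trans (le_of_eq ?_)
      have := (zero_lt_one.trans_le (hc1 m)).ne'
      have := (zero_lt_one.trans_le (hc1 n)).ne'
      field_simp
  rcases le_total n m with h | h
  · refine (main m h).2.trans (mul_le_mul_of_nonneg_right ?_ (norm_nonneg _))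
    rw [div_le_iff₀ (by linarith [hc1 n])]
    linarith [hc1 n, hc2 m]
  · rw [Finset.Ico_eq_empty (by omega), Finset.sum_empty, add_zero]
    linarith [norm_nonneg y]

end Separation

/-! ### Separating and basic subsequences via weak-star limits in the bidual -/

section Existence

variable {𝕜 : Type*} [RCLike 𝕜] {X : Type*} [NormedAddCommGroup X] [NormedSpace 𝕜 X]

open NormedSpace in
/-- A bounded sequence has a weak-star limit along some ultrafilter in the bidual. -/
theorem exists_tendsto_bidual {u : ℕ → X} {R : ℝ} (hu : ∀ k, ‖u k‖ ≤ R) :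
    ∃ ψ : StrongDual 𝕜 (StrongDual 𝕜 X), ∃ l : Filter ℕ, l.NeBot ∧ l ≤ atTop ∧
      ∀ f : StrongDual 𝕜 X, Tendsto (fun k => f (u k)) l (𝓝 (ψ f)) := by
  have hcomp := WeakDual.isCompact_closedBall (𝕜 := 𝕜) (E := StrongDual 𝕜 X) 0 R
  have hle : Filter.map (fun k => StrongDual.toWeakDual (inclusionInDoubleDualLi 𝕜 (u k)))
      (hyperfilter ℕ : Filter ℕ) ≤
      𝓟 (WeakDual.toStrongDual ⁻¹' Metric.closedBall 0 R) := by
    rw [le_principal_iff]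
    refine Filter.mem_map.2 (Filter.Eventually.of_forall (fun k => ?_))
    exact (mem_closedBall_zero_iff (E := StrongDual 𝕜 (StrongDual 𝕜 X))).2
      (((inclusionInDoubleDualLi 𝕜).norm_map (u k)).trans_le (hu k))
  obtain ⟨ψ, -, hψ⟩ := hcomp.ultrafilter_le_nhds
    ((hyperfilter ℕ).map fun k => StrongDual.toWeakDual (inclusionInDoubleDualLi 𝕜 (u k))) hle
  refine ⟨WeakDual.toStrongDual ψ, hyperfilter ℕ, inferInstance, Nat.hyperfilter_le_atTop,
    fun f => ?_⟩
  exact ((WeakDual.eval_continuous f).tendsto ψ).comp hψ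

/-- A vector outside the range of a complete space is at a positive angle to it. -/
theorem exists_norm_le_mul_norm_add_smul [CompleteSpace X] {E : Type*} [NormedAddCommGroup E]
    [NormedSpace 𝕜 E] (J : X →ₗᵢ[𝕜] E) {ψ : E} (hψ : ψ ∉ Set.range J) :
    ∃ d > 0, (∀ y, d ≤ ‖J y - ψ‖) ∧
      ∃ c : ℝ, 1 ≤ c ∧ ∀ (y : X) (a : 𝕜), ‖y‖ ≤ c * ‖J y + a • ψ‖ := by
  have hcl : IsClosed (Set.range J) := J.isometry.isClosedEmbedding.isClosed_range
  have hne : (Set.range J).Nonempty := ⟨J 0, 0, rfl⟩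
  have hd : 0 < Metric.infDist ψ (Set.range J) := (hcl.notMem_iff_infDist_pos hne).1 hψ
  set d := Metric.infDist ψ (Set.range J) with hdd
  have hle : ∀ y, d ≤ ‖J y - ψ‖ := fun y => by
    rw [← dist_eq_norm, dist_comm]
    exact Metric.infDist_le_dist_of_mem ⟨y, rfl⟩
  refine ⟨d, hd, hle, 1 + ‖ψ‖ / d, ?_, fun y a => ?_⟩
  · have : 0 ≤ ‖ψ‖ / d := by positivity
    linarith
  have ha : ‖a‖ * d ≤ ‖J y + a • ψ‖ := by
    rcases eq_or_ne a 0 with rfl | ha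
    · rw [norm_zero, zero_mul]; positivity
    have h1 : J y + a • ψ = (-a) • (J ((-a⁻¹) • y) - ψ) := by
      rw [LinearIsometry.map_smul, smul_sub, smul_smul, neg_mul_neg, mul_inv_cancel₀ ha]
      module
    rw [h1, norm_smul, norm_neg]
    exact mul_le_mul_of_nonneg_left (hle _) (norm_nonneg _)
  have h2 := norm_sub_le (J y + a • ψ) (a • ψ)
  rw [add_sub_cancel_right, LinearIsometry.norm_map, norm_smul] at h2
  have h3 : ‖a‖ * ‖ψ‖ ≤ ‖ψ‖ / d * ‖J y + a • ψ‖ := by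
    rw [div_mul_eq_mul_div, le_div_iff₀ hd, mul_assoc, mul_left_comm]
    exact mul_le_mul_of_nonneg_left ha (norm_nonneg _)
  linarith

/-- Merges the two possible cases for the limit `ψ`: zero, or outside the closed image of `X`.
Either way `J (u k) - ψ` stays away from zero and multiples of `ψ` cannot cancel vectors of `X`. -/
theorem exists_norm_le_mul_norm_sub [CompleteSpace X] {E : Type*} [NormedAddCommGroup E]
    [NormedSpace 𝕜 E] (J : X →ₗᵢ[𝕜] E) {ψ : E} {u : ℕ → X} {d : ℝ} (hd : 0 < d)
    (hud : ∀ k, d ≤ ‖u k‖) (hψ : ψ ∈ Set.range J → ψ = 0) :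
    ∃ d > 0, (∀ k, d ≤ ‖J (u k) - ψ‖) ∧
      ∃ c : ℝ, 1 ≤ c ∧ ∀ (y : X) (a : 𝕜), ‖y‖ ≤ c * ‖J y + a • ψ‖ := by
  by_cases h : ψ ∈ Set.range J
  · obtain rfl := hψ h
    exact ⟨d, hd, fun k => by rw [sub_zero, J.norm_map]; exact hud k, 1, le_rfl,
      fun y a => by rw [smul_zero, add_zero, J.norm_map, one_mul]⟩
  · obtain ⟨d', hd', h1, h2⟩ := exists_norm_le_mul_norm_add_smul J h
    exact ⟨d', hd', fun k => h1 _, h2⟩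

theorem add_sum_smul_add_sum_smul_sub {E ι : Type*} [AddCommGroup E] [Module 𝕜 E] (s : Finset ι)
    (a : ι → 𝕜) (p ψ : E) (v : ι → E) :
    p + (∑ i ∈ s, a i) • ψ + ∑ i ∈ s, a i • (v i - ψ) = p + ∑ i ∈ s, a i • v i := by
  simp only [smul_sub, Finset.sum_sub_distrib, Finset.sum_smul]
  abel

/-- The sequence `J (u k)` need not be weak-star null, but `J (u k) - ψ` is null along `l`. Mazur's
construction applies to these differences, with `ψ` put into every `G N` to absorb the correction.
The constant `K` is fixed before `z`, as the definition of `HasFDSPWith` demands. -/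
theorem exists_separating_subsequence_of_tendsto [CompleteSpace X] {Y : Type*}
    [NormedAddCommGroup Y] [NormedSpace 𝕜 Y] (J : X →ₗᵢ[𝕜] StrongDual 𝕜 Y) (ψ : StrongDual 𝕜 Y)
    {u : ℕ → X} {d : ℝ} (hd : 0 < d) (hud : ∀ k, d ≤ ‖u k‖) {l : Filter ℕ} [l.NeBot]
    (hlt : l ≤ atTop) (hψ : ∀ f, Tendsto (fun k => J (u k) f) l (𝓝 (ψ f)))
    (hzero : ψ ∈ Set.range J → ψ = 0) :
    ∃ K : ℝ, 1 ≤ K ∧ ∀ z : ℕ → X, ∃ φ : ℕ → ℕ, StrictMono φ ∧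
      ∀ n, ∀ p ∈ Submodule.span 𝕜 (z '' Set.Iio n ∪ (u ∘ φ) '' Set.Iio n),
        ∀ q ∈ Submodule.span 𝕜 ((u ∘ φ) '' Set.Ici n), ‖p‖ ≤ K * ‖p + q‖ := by
  obtain ⟨d', hd', hdv, c, hc, hcψ⟩ := exists_norm_le_mul_norm_sub J hd hud hzero
  refine ⟨2 * c, by linarith, fun z => ?_⟩
  let S : ℕ → Set (StrongDual 𝕜 Y) := fun N =>
    insert ψ ((fun i => J (z i)) '' Set.Iio N ∪ (fun i => J (u i)) '' Set.Iio N)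
  have hSfin : ∀ N, (S N).Finite := fun N =>
    (((Set.finite_Iio N).image _).union ((Set.finite_Iio N).image _)).insert _
  have hfd : ∀ N, FiniteDimensional 𝕜 (Submodule.span 𝕜 (S N)) := fun N =>
    FiniteDimensional.span_of_finite 𝕜 (hSfin N)
  have hψS : ∀ N, ψ ∈ Submodule.span 𝕜 (S N) := fun N =>
    Submodule.subset_span (Set.mem_insert _ _)
  obtain ⟨φ, hφ, N, hN, hφN, hsep⟩ := exists_strictMono_norm_le (v := fun k => J (u k) - ψ) hlt hd'
    hdv (fun f => by
      have := (hψ f).sub_const (ψ f)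
      rw [sub_self] at this
      exact this.congr fun k => by rw [sub_apply]) (fun N => Submodule.span 𝕜 (S N))
    (fun N N' h => Submodule.span_mono (Set.insert_subset_insert (Set.union_subset_union
      (Set.image_mono (Set.Iio_subset_Iio h)) (Set.image_mono (Set.Iio_subset_Iio h)))))
    (fun n => sub_mem (Submodule.subset_span (Or.inr (Or.inr ⟨n, Nat.lt_succ_self n, rfl⟩)))
      (hψS _))
  refine ⟨φ, hφ, fun n p hp q hq => ?_⟩
  obtain ⟨a, m, rfl⟩ := exists_eq_sum_Ico_of_mem_span hq
  have hJp : J p ∈ Submodule.span 𝕜 (S (N n)) := by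
    have : Submodule.span 𝕜 (z '' Set.Iio n ∪ (u ∘ φ) '' Set.Iio n) ≤
        (Submodule.span 𝕜 (S (N n))).comap J.toLinearMap := by
      rw [Submodule.span_le]
      rintro _ (⟨i, hi, rfl⟩ | ⟨i, hi, rfl⟩)
      · exact Submodule.subset_span (Or.inr (Or.inl ⟨i, lt_of_lt_of_le hi (hN n), rfl⟩))
      · exact Submodule.subset_span (Or.inr (Or.inr ⟨φ i, hφN i n hi, rfl⟩))
    exact this hp
  -- The multiple of `ψ` is chosen to turn the sum of differences back into a sum of the `J (u (φ
  -- i))`.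
  have h1 := hsep n (J p + (∑ i ∈ Finset.Ico n m, a i) • ψ)
    (add_mem hJp (Submodule.smul_mem _ _ (hψS _))) a m
  have h2 : J p + ∑ i ∈ Finset.Ico n m, a i • J (u (φ i)) =
      J (p + ∑ i ∈ Finset.Ico n m, a i • (u ∘ φ) i) := by
    simp only [map_add, map_sum, LinearIsometry.map_smul, Function.comp_apply]
  have h3 := h1.trans_eq (congrArg (fun e => 2 * ‖e‖)
    ((add_sum_smul_add_sum_smul_sub (Finset.Ico n m) a (J p) ψ (fun i => J (u (φ i)))).trans h2))
  rw [LinearIsometry.norm_map] at h3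
  calc ‖p‖ ≤ c * ‖J p + (∑ i ∈ Finset.Ico n m, a i) • ψ‖ := hcψ _ _
    _ ≤ c * (2 * ‖p + ∑ i ∈ Finset.Ico n m, a i • (u ∘ φ) i‖) :=
      mul_le_mul_of_nonneg_left h3 (by linarith)
    _ = _ := by ring

/-- A bounded, bounded below sequence whose weak cluster points all vanish has separating
subsequences. -/
theorem exists_separating_subsequence [CompleteSpace X] {u : ℕ → X} {R d : ℝ}
    (hu : ∀ k, ‖u k‖ ≤ R) (hd : 0 < d) (hud : ∀ k, d ≤ ‖u k‖)
    (hzero : ∀ (y : X) (l : Filter ℕ), l.NeBot → l ≤ atTop →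
      (∀ f : StrongDual 𝕜 X, Tendsto (fun k => f (u k)) l (𝓝 (f y))) → y = 0) :
    ∃ K : ℝ, 1 ≤ K ∧ ∀ z : ℕ → X, ∃ φ : ℕ → ℕ, StrictMono φ ∧
      ∀ n, ∀ p ∈ Submodule.span 𝕜 (z '' Set.Iio n ∪ (u ∘ φ) '' Set.Iio n),
        ∀ q ∈ Submodule.span 𝕜 ((u ∘ φ) '' Set.Ici n), ‖p‖ ≤ K * ‖p + q‖ := by
  obtain ⟨ψ, l, hl, hlt, hψ⟩ := exists_tendsto_bidual (𝕜 := 𝕜) hu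
  refine exists_separating_subsequence_of_tendsto (NormedSpace.inclusionInDoubleDualLi 𝕜) ψ hd hud
    hlt hψ ?_
  rintro ⟨y, rfl⟩
  rw [hzero y l hl hlt hψ]
  ext f
  exact map_zero f

/-- A biorthogonal sequence with uniformly separated head and tail spans is basic. -/
theorem isBasicWith_of_norm_le {u : ℕ → X} {us : ℕ → StrongDual 𝕜 X}
    (hortho : ∀ i j, us i (u j) = if i = j then 1 else 0) {K : ℝ}
    (hK : ∀ n, ∀ p ∈ Submodule.span 𝕜 (u '' Set.Iio n),
      ∀ q ∈ Submodule.span 𝕜 (u '' Set.Ici n), ‖p‖ ≤ K * ‖p + q‖) (hK0 : 0 ≤ K) :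
    IsBasicWith 𝕜 u K := by
  let P : ℕ → X →L[𝕜] X := fun n => ∑ i ∈ Finset.range n, (us i).smulRight (u i)
  have hP : ∀ n y, P n y = ∑ i ∈ Finset.range n, us i y • u i := fun n y => by
    simp [P]
  have hPu : ∀ n j, P n (u j) = if j < n then u j else 0 := fun n j => by
    simp [hP, hortho]
  have hspan : ∀ y ∈ Submodule.span 𝕜 (Set.range u), ∃ N, ∀ n, N ≤ n → P n y = y := by
    intro y hy
    induction hy using Submodule.span_induction with
    | mem y hy =>
      obtain ⟨j, rfl⟩ := hy
      exact ⟨j + 1, fun n hn => by rw [hPu, if_pos (by omega)]⟩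
    | zero => exact ⟨0, fun n _ => map_zero _⟩
    | add y z _ _ hy hz =>
      obtain ⟨N, hN⟩ := hy
      obtain ⟨N', hN'⟩ := hz
      exact ⟨max N N', fun n hn => by
        rw [map_add, hN n (le_trans (le_max_left _ _) hn), hN' n (le_trans (le_max_right _ _) hn)]⟩
    | smul a y _ hy =>
      obtain ⟨N, hN⟩ := hy
      exact ⟨N, fun n hn => by rw [map_smul, hN n hn]⟩
  have htail : ∀ n, ∀ y ∈ Submodule.span 𝕜 (Set.range u),
      y - P n y ∈ Submodule.span 𝕜 (u '' Set.Ici n) := by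
    intro n y hy
    induction hy using Submodule.span_induction with
    | mem y hy =>
      obtain ⟨j, rfl⟩ := hy
      rw [hPu]
      split_ifs with h
      · rw [sub_self]; exact zero_mem _
      · rw [sub_zero]; exact Submodule.subset_span ⟨j, not_lt.1 h, rfl⟩
    | zero => rw [map_zero, sub_zero]; exact zero_mem _
    | add y z _ _ hy hz => rw [map_add, add_sub_add_comm]; exact add_mem hy hz
    | smul a y _ hy => rw [map_smul, ← smul_sub]; exact Submodule.smul_mem _ _ hy
  have hhead : ∀ n y, P n y ∈ Submodule.span 𝕜 (u '' Set.Iio n) := fun n y => by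
    rw [hP]
    exact Submodule.sum_mem _ fun i hi => Submodule.smul_mem _ _
      (Submodule.subset_span ⟨i, Finset.mem_range.1 hi, rfl⟩)
  have hbound : ∀ n, ∀ y ∈ (Submodule.span 𝕜 (Set.range u)).topologicalClosure,
      ‖P n y‖ ≤ K * ‖y‖ := by
    intro n y hy
    have hcl : IsClosed {y | ‖P n y‖ ≤ K * ‖y‖} := isClosed_le (by fun_prop) (by fun_prop)
    -- On the span, `y` splits into its head `P n y` and a tail, so the separation hypothesis is the
    -- bound; closedness extends it.
    refine hcl.closure_subset_iff.2 (fun y hy => ?_) hy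
    have := hK n _ (hhead n y) _ (htail n y hy)
    rwa [add_sub_cancel] at this
  have hmem : ∀ k, u k ∈ (Submodule.span 𝕜 (Set.range u)).topologicalClosure := fun k =>
    Submodule.le_topologicalClosure _ (Submodule.subset_span ⟨k, rfl⟩)
  have hconv : ∀ y ∈ (Submodule.span 𝕜 (Set.range u)).topologicalClosure,
      Tendsto (fun n => P n y) atTop (𝓝 y) := by
    intro y hy
    rw [Metric.tendsto_atTop]
    intro ε hε
    obtain ⟨y', hy', hdist⟩ := Metric.mem_closure_iff.1 hy (ε / (K + 1)) (by positivity)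
    obtain ⟨N, hN⟩ := hspan y' hy'
    refine ⟨N, fun n hn => ?_⟩
    have h1 := hbound n (y - y') (sub_mem hy (Submodule.le_topologicalClosure _ hy'))
    rw [map_sub, hN n hn] at h1
    rw [dist_eq_norm] at hdist ⊢
    rw [lt_div_iff₀ (by positivity)] at hdist
    calc ‖P n y - y‖ = ‖(P n y - y') - (y - y')‖ := by congr 1; abel
      _ ≤ ‖P n y - y'‖ + ‖y - y'‖ := norm_sub_le _ _
      _ < ε := by linarith
  let b : SchauderBasis 𝕜 (Submodule.span 𝕜 (Set.range u)).topologicalClosure :=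
    { basis := fun k => ⟨u k, hmem k⟩
      coord := fun k => (us k).comp (Submodule.subtypeL _)
      ortho := fun i j => by
        simp [hortho, Pi.single_apply]
      expansion := fun y => by
        rw [HasSum, SummationFilter.conditional_filter_eq_map_range, tendsto_map'_iff,
          tendsto_subtype_rng]
        refine (hconv y y.2).congr fun n => ?_
        simp [hP] }
  refine ⟨b, fun k => rfl, fun n => ?_⟩
  refine ContinuousLinearMap.opNorm_le_bound _ hK0 fun y => ?_
  have h1 : ((b.proj n y : _) : X) = P n y := by
    rw [SchauderBasis.proj_apply, hP, Submodule.coe_sum]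
    rfl
  rw [← Submodule.norm_coe, h1]
  exact hbound n y y.2

end Existence

/-! ### Existence and attainment of the separation constant -/

section SeparationConstant

variable {𝕜 : Type*} [RCLike 𝕜] {X : Type*} [NormedAddCommGroup X] [NormedSpace 𝕜 X]

/-- Separation from the terms of a dense sequence passes to finite dimensional subspaces. -/
theorem exists_norm_le_of_finiteDimensional {u z : ℕ → X} {K : ℝ} (hK1 : 1 ≤ K)
    (hK : ∀ i n, i < n → ∀ q ∈ Submodule.span 𝕜 (u '' Set.Ici n), ‖z i‖ ≤ K * ‖z i + q‖)
    (F : Submodule 𝕜 X) [FiniteDimensional 𝕜 F] (hF : (F : Set X) ⊆ closure (Set.range z)) :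
    ∃ j : ℕ, ∀ y ∈ F, ∀ q ∈ (Submodule.span 𝕜 (u '' Set.Ioi j)).topologicalClosure,
      ‖y‖ ≤ 2 * K * ‖y + q‖ := by
  have hK0 : 0 < K := by linarith
  have hcomp : IsCompact (Subtype.val '' Metric.sphere (0 : F) 1) := by
    have : ProperSpace F := FiniteDimensional.proper 𝕜 F
    exact (isCompact_sphere _ _).image continuous_subtype_val
  -- Replacing a unit vector by the nearby `z i` costs at most 1/4 in its own norm and 1/4 after
  -- multiplication by `K`; the remaining 1/2 explains the constant `2 * K`.
  have hδ : 0 < 1 / (4 * K) := by positivity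
  obtain ⟨t, ht⟩ := hcomp.elim_finite_subcover (fun i => Metric.ball (z i) (1 / (4 * K)))
    (fun i => Metric.isOpen_ball) (by
      rintro _ ⟨y, hy, rfl⟩
      obtain ⟨_, ⟨i, rfl⟩, hi⟩ := Metric.mem_closure_iff.1 (hF y.2) _ hδ
      exact Set.mem_iUnion.2 ⟨i, hi⟩)
  refine ⟨t.sup id, fun y hy q hq => ?_⟩
  have unit : ∀ y ∈ F, ‖y‖ = 1 → ∀ q ∈ Submodule.span 𝕜 (u '' Set.Ioi (t.sup id)),
      1 ≤ 2 * K * ‖y + q‖ := by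
    intro y hy hy1 q hq
    have := ht ⟨⟨y, hy⟩, mem_sphere_zero_iff_norm.2 hy1, rfl⟩
    simp only [Set.mem_iUnion, Metric.mem_ball, dist_eq_norm] at this
    obtain ⟨i, hi, hyi⟩ := this
    have hq' : q ∈ Submodule.span 𝕜 (u '' Set.Ici (t.sup id + 1)) := by
      refine Submodule.span_mono (Set.image_mono fun k hk => ?_) hq
      exact Nat.succ_le_of_lt hk
    have h1 := hK i _ (Nat.lt_succ_of_le (Finset.le_sup (f := id) hi)) q hq'
    have h2 : ‖z i + q‖ ≤ ‖y + q‖ + ‖y - z i‖ := by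
      have := norm_sub_le (y + q) (y - z i)
      rwa [show y + q - (y - z i) = z i + q by abel] at this
    have h3 : 1 ≤ ‖z i‖ + ‖y - z i‖ := by
      have := norm_add_le (z i) (y - z i)
      rwa [add_sub_cancel, hy1] at this
    have h4 : K * ‖z i + q‖ ≤ K * (‖y + q‖ + ‖y - z i‖) := mul_le_mul_of_nonneg_left h2 hK0.le
    have h5 : K * ‖y - z i‖ ≤ 1 / 4 := by
      calc K * ‖y - z i‖ ≤ K * (1 / (4 * K)) := mul_le_mul_of_nonneg_left hyi.le hK0.le
        _ = 1 / 4 := by field_simp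
    have h6 : ‖y - z i‖ ≤ 1 / 4 := by nlinarith [norm_nonneg (y - z i)]
    linarith
  have hspan : ∀ q ∈ Submodule.span 𝕜 (u '' Set.Ioi (t.sup id)), ‖y‖ ≤ 2 * K * ‖y + q‖ := by
    intro q hq
    rcases eq_or_ne y 0 with rfl | hy0
    · rw [norm_zero]; positivity
    have hn : ‖y‖ ≠ 0 := norm_ne_zero_iff.2 hy0
    have h := unit (((‖y‖ : ℝ) : 𝕜)⁻¹ • y) (F.smul_mem _ hy) (by simp [norm_smul, hn])
      (((‖y‖ : ℝ) : 𝕜)⁻¹ • q) (Submodule.smul_mem _ _ hq)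
    rw [← smul_add, norm_smul, norm_inv, RCLike.norm_ofReal, abs_norm, mul_left_comm,
      inv_mul_eq_div, le_div_iff₀ (norm_pos_iff.2 hy0), one_mul] at h
    exact h
  have hcl : IsClosed {q | ‖y‖ ≤ 2 * K * ‖y + q‖} := isClosed_le (by fun_prop) (by fun_prop)
  exact hcl.closure_subset_iff.2 hspan hq

/-- A weak limit of the basis vectors along a filter finer than `atTop` has all coordinates zero by
biorthogonality, hence vanishes by totality. Biorthogonality also gives the lower norm bound `R'⁻¹`.
-/
theorem IsMarkushevichBasis.exists_hasFDSPWith [CompleteSpace X] {x : ℕ → X}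
    {xs : ℕ → StrongDual 𝕜 X} (h : IsMarkushevichBasis 𝕜 x xs) {R R' : ℝ} (hx : ∀ i, ‖x i‖ ≤ R)
    (hxs : ∀ i, ‖xs i‖ ≤ R') {φ : ℕ → ℕ} (hφ : StrictMono φ) : ∃ M, HasFDSPWith 𝕜 (x ∘ φ) M := by
  have hone : ∀ i, 1 ≤ R' * ‖x i‖ := fun i => by
    have h1 := (xs i).le_of_opNorm_le (hxs i) (x i)
    rwa [h.biorthogonal, if_pos rfl, norm_one] at h1
  have hR' : 0 < R' := by
    by_contra hR'
    have := mul_nonpos_of_nonpos_of_nonneg (not_lt.1 hR') (norm_nonneg (x 0))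
    linarith [hone 0]
  have hzero : ∀ (y : X) (l : Filter ℕ), l.NeBot → l ≤ atTop →
      (∀ f : StrongDual 𝕜 X, Tendsto (fun k => f ((x ∘ φ) k)) l (𝓝 (f y))) → y = 0 := by
    intro y l hl hlt hy
    refine h.eq_zero fun i => tendsto_nhds_unique (hy (xs i)) ?_
    refine tendsto_const_nhds.congr' ?_
    filter_upwards [hlt (eventually_gt_atTop i)] with k hk
    rw [Function.comp_apply, h.biorthogonal, if_neg]
    exact (lt_of_lt_of_le hk (hφ.id_le k)).ne
  obtain ⟨K, hK1, hK⟩ := exists_separating_subsequence (𝕜 := 𝕜) (u := x ∘ φ) (d := R'⁻¹)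
    (fun k => hx _) (by positivity)
    (fun k => by rw [inv_le_iff_one_le_mul₀' hR']; exact hone _) hzero
  refine ⟨2 * K, by linarith, fun Z hZ ε hε => ?_⟩
  obtain ⟨c, hc, hZc⟩ := hZ
  have hcne : c.Nonempty := by
    by_contra hne
    rw [Set.not_nonempty_iff_eq_empty] at hne
    have := hZc Z.zero_mem
    rw [hne, closure_empty] at this
    exact this
  obtain ⟨z, rfl⟩ := hc.exists_eq_range hcne
  obtain ⟨ψ, hψ, hsep⟩ := hK z
  refine ⟨ψ, hψ, isBasicWith_of_norm_le (us := xs ∘ φ ∘ ψ) (fun i j => ?_) (fun n p hp q hq => ?_)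
    (by linarith), fun F hFZ hF => ?_⟩
  · simp only [Function.comp_apply, h.biorthogonal,  hφ.injective.eq_iff, hψ.injective.eq_iff]
  · refine (hsep n p (Submodule.span_mono Set.subset_union_right hp) q hq).trans ?_
    exact mul_le_mul_of_nonneg_right (by linarith) (norm_nonneg _)
  · obtain ⟨j, hj⟩ := exists_norm_le_of_finiteDimensional hK1 (u := x ∘ φ ∘ ψ) (z := z)
      (fun i n hi q hq => hsep n (z i) (Submodule.subset_span (Or.inl ⟨i, hi, rfl⟩)) q hq) F
      (Set.Subset.trans hFZ hZc)
    refine ⟨j, fun y hy q hq => (hj y hy q hq).trans ?_⟩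
    exact mul_le_mul_of_nonneg_right (by linarith) (norm_nonneg _)

theorem HasFDSPWith.one_le {u : ℕ → X} {M : ℝ} (h : HasFDSPWith 𝕜 u M) (hu : ∀ k, u k ≠ 0) :
    1 ≤ M := by
  refine le_of_forall_pos_le_add fun ε hε => ?_
  obtain ⟨φ, -, -, hF⟩ := h.2 (Submodule.span 𝕜 {u 0})
    (Set.countable_singleton (u 0)).isSeparable.span ε hε
  obtain ⟨j, hj⟩ := hF _ le_rfl inferInstance
  have := hj (u 0) (Submodule.mem_span_singleton_self _) 0 (zero_mem _)
  rw [add_zero] at this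
  exact le_of_mul_le_mul_right (by rwa [one_mul]) (norm_pos_iff.2 (hu 0))

/-- The separation constant is attained. -/
theorem isLeast_fdsConstant {u : ℕ → X} (hu : ∀ k, u k ≠ 0) (hex : ∃ M, HasFDSPWith 𝕜 u M) :
    IsLeast {M | HasFDSPWith 𝕜 u M} (fdsConstant 𝕜 u) := by
  have hbdd : BddBelow {M | HasFDSPWith 𝕜 u M} := ⟨1, fun M hM => HasFDSPWith.one_le hM hu⟩
  refine ⟨⟨?_, fun Z hZ ε hε => ?_⟩, fun M hM => csInf_le hbdd hM⟩
  · exact zero_lt_one.trans_le (le_csInf hex fun M hM => HasFDSPWith.one_le hM hu)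
  · obtain ⟨M, hM, hlt⟩ := exists_lt_of_csInf_lt hex
      (show fdsConstant 𝕜 u < fdsConstant 𝕜 u + ε by linarith)
    have := hM.2 Z hZ (fdsConstant 𝕜 u + ε - M) (by linarith)
    rwa [add_sub_cancel] at this

end SeparationConstant

/-! ### Weights of finite sets and the choice of blocks -/

section Weights

variable {w : ℕ → ℝ}

theorem wMeasure_mono {A B : Set ℕ} (h : A ⊆ B) : wMeasure w A ≤ wMeasure w B :=
  ENNReal.tsum_mono_subtype (fun i => ENNReal.ofReal (w i)) h

theorem wMeasure_coe_finset (hw : ∀ i, 0 < w i) (A : Finset ℕ) :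
    wMeasure w A = ENNReal.ofReal (∑ i ∈ A, w i) := by
  rw [wMeasure, Finset.tsum_subtype' A fun i => ENNReal.ofReal (w i),
    ENNReal.ofReal_sum_of_nonneg fun i _ => (hw i).le]

theorem wMeasure_coe_le_wMeasure_coe (hw : ∀ i, 0 < w i) {A B : Finset ℕ} :
    wMeasure w A ≤ wMeasure w B ↔ ∑ i ∈ A, w i ≤ ∑ i ∈ B, w i := by
  rw [wMeasure_coe_finset hw, wMeasure_coe_finset hw,
    ENNReal.ofReal_le_ofReal_iff (Finset.sum_nonneg fun i _ => (hw i).le)]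

/-- Far away blocks of prescribed weight, up to a factor two. -/
theorem exists_block {T : Set ℕ} (hT : T.Infinite) {δ : ℝ} (hδ : 0 < δ)
    (hTδ : ∀ i ∈ T, δ ≤ w i) {W : ℝ} (hW : 0 < W) {K : ℕ} (hK : ∀ i ∈ T, K ≤ i → w i ≤ W) (N : ℕ) :
    ∃ B : Finset ℕ, (B : Set ℕ) ⊆ T ∩ Set.Ici N ∧ W / 2 ≤ ∑ i ∈ B, w i ∧ ∑ i ∈ B, w i ≤ W := by
  have main : ∀ n : ℕ, ∃ B : Finset ℕ, (B : Set ℕ) ⊆ T ∩ Set.Ici N ∧ ∑ i ∈ B, w i ≤ W ∧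
      (W / 2 ≤ ∑ i ∈ B, w i ∨ n * δ ≤ ∑ i ∈ B, w i) := by
    intro n
    induction n with
    | zero => exact ⟨∅, by simp, by simpa using hW.le, Or.inr (by simp)⟩
    | succ n ih =>
      obtain ⟨B, hB, hBW, hBn⟩ := ih
      by_cases hlarge : W / 2 ≤ ∑ i ∈ B, w i
      · exact ⟨B, hB, hBW, Or.inl hlarge⟩
      have hBn' := hBn.resolve_left hlarge
      push Not at hlarge
      obtain ⟨i, hiT, hi⟩ := hT.exists_gt (max (max N K) (B.sup id))
      have hiN : N ≤ i := by omega
      have hiK : K ≤ i := by omega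
      have hiB : i ∉ B := fun h => by
        have := Finset.le_sup (f := id) h
        simp only [id] at this
        omega
      -- A heavy index forms a block alone; a light one can be added without exceeding `W`. Each
      -- addition contributes at least `δ`, so `W / 2` is eventually reached.
      by_cases hwi : W / 2 ≤ w i
      · exact ⟨{i}, by simpa using ⟨hiT, hiN⟩, by simpa using hK i hiT hiK,
          Or.inl (by simpa using hwi)⟩
      · push Not at hwi
        refine ⟨insert i B, ?_, ?_, Or.inr ?_⟩
        · rw [Finset.coe_insert]
          exact Set.insert_subset ⟨hiT, hiN⟩ hB
        · rw [Finset.sum_insert hiB]; linarith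
        · rw [Finset.sum_insert hiB]
          push_cast
          linarith [hTδ i hiT]
  obtain ⟨n, hn⟩ := exists_nat_ge (W / 2 / δ)
  obtain ⟨B, hB, hBW, hBn⟩ := main n
  refine ⟨B, hB, hBn.elim id fun h => le_trans ?_ h, hBW⟩
  rwa [div_le_iff₀ hδ] at hn

end Weights

/-! ### Coordinates with respect to the Markushevich basis -/

section Coordinates

variable {𝕜 : Type*} [RCLike 𝕜] {X : Type*} [NormedAddCommGroup X] [NormedSpace 𝕜 X]
  {x : ℕ → X} {xs : ℕ → StrongDual 𝕜 X}

theorem IsMarkushevichBasis.coord_sum (h : IsMarkushevichBasis 𝕜 x xs) (A : Finset ℕ) (c : ℕ → 𝕜)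
    (j : ℕ) : xs j (∑ i ∈ A, c i • x i) = if j ∈ A then c j else 0 := by
  simp [h.biorthogonal]

theorem IsMarkushevichBasis.supp_sum_subset (h : IsMarkushevichBasis 𝕜 x xs) (A : Finset ℕ)
    (c : ℕ → 𝕜) : supp xs (∑ i ∈ A, c i • x i) ⊆ A := by
  intro j hj
  by_contra hjA
  exact hj (by rw [h.coord_sum, if_neg (Finset.mem_coe.not.1 hjA)])

theorem IsMarkushevichBasis.eq_proj (h : IsMarkushevichBasis 𝕜 x xs) {A : Finset ℕ} {y : X}
    (hy : supp xs y ⊆ A) : y = proj x xs A y := by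
  rw [← sub_eq_zero]
  refine h.eq_zero fun j => ?_
  rw [map_sub, proj, h.coord_sum]
  split_ifs with hj
  · exact sub_self _
  · rw [sub_zero]
    by_contra hne
    exact hj (hy hne)

theorem proj_mem_span (A : Finset ℕ) (y : X) {S : Set ℕ} (hA : (A : Set ℕ) ⊆ S) :
    proj x xs A y ∈ Submodule.span 𝕜 (x '' S) :=
  Submodule.sum_mem _ fun i hi =>
    Submodule.smul_mem _ _ (Submodule.subset_span ⟨i, hA hi, rfl⟩)

theorem IsMarkushevichBasis.exists_forall_norm_coord_lt (h : IsMarkushevichBasis 𝕜 x xs) {R' : ℝ}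
    (hxs : ∀ i, ‖xs i‖ ≤ R') (y : X) {η : ℝ} (hη : 0 < η) :
    ∃ N, ∀ i, N ≤ i → ‖xs i y‖ < η := by
  have hR' : 0 ≤ R' := (norm_nonneg _).trans (hxs 0)
  have hy : y ∈ closure (Submodule.span 𝕜 (Set.range x) : Set X) := by
    rw [← Submodule.topologicalClosure_coe, h.fundamental]
    trivial
  obtain ⟨y', hy', hdist⟩ := Metric.mem_closure_iff.1 hy (η / (R' + 1)) (by positivity)
  have hev : ∃ N, ∀ i, N ≤ i → xs i y' = 0 := by
    clear hdist
    induction hy' using Submodule.span_induction with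
    | mem y hy =>
      obtain ⟨j, rfl⟩ := hy
      exact ⟨j + 1, fun i hi => by rw [h.biorthogonal, if_neg (by omega)]⟩
    | zero => exact ⟨0, fun i _ => map_zero _⟩
    | add y z _ _ hy hz =>
      obtain ⟨N, hN⟩ := hy
      obtain ⟨N', hN'⟩ := hz
      exact ⟨max N N', fun n hn => by
        rw [map_add, hN n (le_trans (le_max_left _ _) hn), hN' n (le_trans (le_max_right _ _) hn),
          add_zero]⟩
    | smul a y _ hy =>
      obtain ⟨N, hN⟩ := hy
      exact ⟨N, fun n hn => by rw [map_smul, hN n hn, smul_zero]⟩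
  obtain ⟨N, hN⟩ := hev
  refine ⟨N, fun i hi => ?_⟩
  have h1 := (xs i).le_of_opNorm_le (hxs i) (y - y')
  rw [map_sub, hN i hi, sub_zero] at h1
  rw [dist_eq_norm, lt_div_iff₀ (by positivity)] at hdist
  have := norm_nonneg (y - y')
  linarith

theorem IsMarkushevichBasis.finite_setOf_le_norm_coord (h : IsMarkushevichBasis 𝕜 x xs) {R' : ℝ}
    (hxs : ∀ i, ‖xs i‖ ≤ R') (y : X) {η : ℝ} (hη : 0 < η) : {i | η ≤ ‖xs i y‖}.Finite := by
  obtain ⟨N, hN⟩ := h.exists_forall_norm_coord_lt hxs y hη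
  refine (Set.finite_Iio N).subset fun i hi => ?_
  by_contra hNi
  exact absurd (hN i (not_lt.1 hNi)) (not_lt.2 hi)

theorem exists_mem_notMem_of_card_eq {A B : Finset ℕ} (hcard : A.card = B.card) (hne : A ≠ B) :
    (∃ i ∈ A, i ∉ B) ∧ ∃ j ∈ B, j ∉ A := by
  constructor
  · by_contra! hsub
    exact hne (Finset.eq_of_subset_of_card_le hsub hcard.ge)
  · by_contra! hsub
    exact hne (Finset.eq_of_subset_of_card_le hsub hcard.le).symm

end Coordinates

/-! ### The two tests of the semi-greedy inequality -/

section SemiGreedy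

variable {𝕜 : Type*} [RCLike 𝕜] {X : Type*} [NormedAddCommGroup X] [NormedSpace 𝕜 X]
  {x : ℕ → X} {xs : ℕ → StrongDual 𝕜 X} {w : ℕ → ℝ} {s C R R' : ℝ}

/-- A vector with small coordinates is dominated by its perturbations by far away blocks with
large coordinates, up to vectors of smaller weight. -/
theorem IsWeakSemiGreedy.exists_norm_le_of_far (hsg : IsWeakSemiGreedy xs w s C)
    (h : IsMarkushevichBasis 𝕜 x xs) (hxs : ∀ i, ‖xs i‖ ≤ R') (hs : 0 < s)
    {T : Set ℕ} {M : ℝ} (hM : 0 ≤ M) {v : X}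
    (hsep : ∃ N, ∀ z ∈ Submodule.span 𝕜 (x '' (T ∩ Set.Ici N)), ‖v‖ ≤ M * ‖v + z‖)
    {α : ℝ} (hα : 0 < α) (hv : ∀ i, ‖xs i v‖ ≤ α) :
    ∃ N, ∀ B : Finset ℕ, B.Nonempty → (B : Set ℕ) ⊆ T ∩ Set.Ici N → ∀ ε : ℕ → 𝕜,
      (∀ i ∈ B, ‖ε i‖ = 1) → ∀ z : X, (supp xs z).Finite →
        wMeasure w (supp xs z) ≤ wMeasure w B →
          ‖v‖ ≤ M * (C * ‖v + ((6 / 5 * α / s : ℝ) : 𝕜) • ∑ i ∈ B, ε i • x i - z‖) := by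
  obtain ⟨N₁, hN₁⟩ := hsep
  obtain ⟨N₂, hN₂⟩ := h.exists_forall_norm_coord_lt hxs v (η := α / s / 10) (by positivity)
  refine ⟨max N₁ N₂, fun B hBne hB ε hε z hz hzB => ?_⟩
  set τ : ℝ := 6 / 5 * α / s with hτ
  have hτ0 : 0 < τ := by positivity
  set b := ∑ i ∈ B, ε i • x i with hb
  have hcoord : ∀ i, xs i (v + (τ : 𝕜) • b) = xs i v + if i ∈ B then (τ : 𝕜) * ε i else 0 := by
    intro i
    rw [map_add, map_smul, hb, h.coord_sum, smul_eq_mul]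
    split_ifs <;> simp
  obtain ⟨A, ⟨hAcard, hA⟩, y, hyA, hy⟩ := hsg (v + (τ : 𝕜) • b) B.card hBne.card_pos
  -- On `B` the coordinates exceed `τ - α / s / 10 = 11 / 10 * α / s`, while off `B` they are at
  -- most `α`. Omitting an index of `B` would thus violate `s`-greediness.
  have hAB : A = B := by
    by_contra hne
    obtain ⟨⟨i, hiA, hiB⟩, j, hjB, hjA⟩ := exists_mem_notMem_of_card_eq hAcard hne
    have h1 := hA i hiA j hjA
    rw [hcoord, hcoord, if_pos hjB, if_neg hiB, add_zero] at h1
    have h2 : τ - ‖xs j v‖ ≤ ‖xs j v + (τ : 𝕜) * ε j‖ := by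
      have := norm_sub_le (xs j v + (τ : 𝕜) * ε j) (xs j v)
      rw [add_sub_cancel_left, norm_mul, hε j hjB, RCLike.norm_ofReal, abs_of_pos hτ0] at this
      linarith
    have h3 := hN₂ j (le_trans (le_max_right _ _) (hB hjB).2)
    have h4 : s * (τ - α / s / 10) ≤ s * ‖xs j v + (τ : 𝕜) * ε j‖ :=
      mul_le_mul_of_nonneg_left (by linarith) hs.le
    have h5 : s * (τ - α / s / 10) = 11 / 10 * α := by rw [hτ]; field_simp; ring
    linarith [hv i]
  subst hAB
  have hAN : (A : Set ℕ) ⊆ T ∩ Set.Ici N₁ := fun i hi =>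
    ⟨(hB hi).1, Set.mem_Ici.2 (le_trans (le_max_left _ _) (hB hi).2)⟩
  have hmem : (τ : 𝕜) • b - y ∈ Submodule.span 𝕜 (x '' (T ∩ Set.Ici N₁)) := by
    refine sub_mem (Submodule.smul_mem _ _ (Submodule.sum_mem _ fun i hi =>
      Submodule.smul_mem _ _ (Submodule.subset_span ⟨i, hAN hi, rfl⟩))) ?_
    rw [h.eq_proj hyA]
    exact proj_mem_span _ _ hAN
  have h1 := hN₁ _ hmem
  rw [← add_sub_assoc] at h1
  exact h1.trans (mul_le_mul_of_nonneg_left (hy z hz hzB) hM)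

/-- Approximation of `g` after adding a far away block of small coordinates and small weight. -/
theorem IsWeakSemiGreedy.exists_approx (hsg : IsWeakSemiGreedy xs w s C)
    (h : IsMarkushevichBasis 𝕜 x xs) (hxs : ∀ i, ‖xs i‖ ≤ R') (hs : 0 < s) (hs1 : s ≤ 1) {g : X}
    {D : Finset ℕ} (hD : ∀ i ∈ D, 1 ≤ ‖xs i g‖) (hDne : D.Nonempty) {N : ℕ}
    (hN : ∀ i, N ≤ i → ‖xs i g‖ < s ^ 2 / 20) {B : Finset ℕ} (hBN : (B : Set ℕ) ⊆ Set.Ici N)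
    (hBD : wMeasure w B ≤ wMeasure w D) :
    ∃ y, supp xs y ⊆ Finset.range N ∧
      ‖g + ((9 / 10 * s ^ 2 : ℝ) : 𝕜) • ∑ i ∈ B, x i - y‖ ≤ C * ‖g‖ := by
  classical
  have hs2 : s ^ 2 ≤ s := by nlinarith
  have hs2' : 0 < s ^ 2 := by positivity
  set t : ℝ := 9 / 10 * s ^ 2 with ht
  set b := ∑ i ∈ B, x i with hb
  have hbs : b = ∑ i ∈ B, (1 : 𝕜) • x i := by simp [hb]
  have hcoordN : ∀ i, i ∉ B → xs i (g + (t : 𝕜) • b) = xs i g := by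
    intro i hi
    rw [map_add, map_smul, hbs, h.coord_sum, if_neg hi, smul_zero, add_zero]
  have hcoordB : ∀ i ∈ B, ‖xs i (g + (t : 𝕜) • b)‖ < s ^ 2 := by
    intro i hi
    rw [map_add, map_smul, hbs, h.coord_sum, if_pos hi, smul_eq_mul, mul_one]
    refine (norm_add_le _ _).trans_lt ?_
    rw [RCLike.norm_ofReal, abs_of_nonneg (by positivity)]
    have := hN i (hBN hi)
    linarith
  -- The threshold `s` and the cardinality of `E` are tuned so that an `s`-greedy set `A` of this
  -- size has coordinates at least `s ^ 2`, missing `B` where they are below `19 / 20 * s ^ 2`. If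
  -- `A` omitted a point of `D`, its coordinates would be at least `s`, forcing `A = E ⊇ D`.
  set E := (h.finite_setOf_le_norm_coord hxs g hs).toFinset with hE
  have hEmem : ∀ i, i ∈ E ↔ s ≤ ‖xs i g‖ := fun i => by simp [hE]
  have hDE : D ⊆ E := fun i hi => (hEmem i).2 (hs1.trans (hD i hi))
  have hEB : ∀ i ∈ E, i ∉ B := fun i hi hiB => by
    have := hN i (hBN hiB)
    have := (hEmem i).1 hi
    linarith
  obtain ⟨A, ⟨hAcard, hA⟩, y, hyA, hy⟩ := hsg (g + (t : 𝕜) • b) E.card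
    (hDne.mono hDE).card_pos
  have hAlarge : ∀ i ∈ A, s ^ 2 ≤ ‖xs i (g + (t : 𝕜) • b)‖ := by
    intro i hi
    by_cases hAE : A = E
    · subst hAE
      rw [hcoordN i (hEB i hi)]
      exact hs2.trans ((hEmem i).1 hi)
    · obtain ⟨-, j, hjE, hjA⟩ := exists_mem_notMem_of_card_eq hAcard hAE
      have h1 := hA i hi j hjA
      rw [hcoordN j (hEB j hjE)] at h1
      have h2 := mul_le_mul_of_nonneg_left ((hEmem j).1 hjE) hs.le
      nlinarith
  have hAB : ∀ i ∈ A, i ∉ B := fun i hi hiB => absurd (hcoordB i hiB) (not_lt.2 (hAlarge i hi))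
  have hDA : D ⊆ A := by
    intro j hj
    by_contra hjA
    have hAE : A ⊆ E := by
      intro i hi
      have h1 := hA i hi j hjA
      rw [hcoordN j (hEB j (hDE hj)), hcoordN i (hAB i hi)] at h1
      rw [hEmem]
      have h2 := mul_le_mul_of_nonneg_left (hD j hj) hs.le
      linarith
    exact hjA (Finset.eq_of_subset_of_card_le hAE hAcard.ge ▸ hDE hj)
  refine ⟨y, hyA.trans fun i hi => ?_, ?_⟩
  · rw [Finset.coe_range]
    by_contra hiN
    have h1 := hAlarge i hi
    rw [hcoordN i (hAB i hi)] at h1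
    have := hN i (not_lt.1 hiN)
    linarith
  · have hsupp : supp xs ((t : 𝕜) • b) ⊆ B := by
      rw [hbs, Finset.smul_sum]
      simp_rw [smul_smul]
      exact h.supp_sum_subset B _
    have h1 := hy ((t : 𝕜) • b) (B.finite_toSet.subset hsupp)
      -- The added block itself is an admissible competitor, leaving just `g` on the right.
      ((wMeasure_mono hsupp).trans (hBD.trans (wMeasure_mono (Finset.coe_subset.2 hDA))))
    rwa [add_sub_cancel_right] at h1

/-- Far away vectors with unimodular coordinates, of large weight and small norm. -/
theorem IsWeakSemiGreedy.exists_far_unimodular (hsg : IsWeakSemiGreedy xs w s C)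
    (h : IsMarkushevichBasis 𝕜 x xs) (hx : ∀ i, ‖x i‖ ≤ R) (hxs : ∀ i, ‖xs i‖ ≤ R')
    (hw : ∀ i, 0 < w i) (hC : 0 < C) (hs : 0 < s) (hs1 : s ≤ 1) {T : Set ℕ} (hT : T.Infinite)
    {δ : ℝ} (hδ : 0 < δ) (hTδ : ∀ i ∈ T, δ ≤ w i) {g : X} {D : Finset ℕ}
    (hD : ∀ i ∈ D, 1 ≤ ‖xs i g‖) (hDne : D.Nonempty) (N : ℕ) :
    ∃ B : Finset ℕ, B.Nonempty ∧ (B : Set ℕ) ⊆ T ∩ Set.Ici N ∧ ∑ i ∈ D, w i ≤ ∑ i ∈ B, w i ∧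
      ∃ ε : ℕ → 𝕜, (∀ i ∈ B, ‖ε i‖ = 1) ∧
        ‖∑ i ∈ B, ε i • x i‖ ≤ max (R * R') (5 / 2 * C * (s ^ 2)⁻¹) * ‖g‖ := by
  classical
  set W := ∑ i ∈ D, w i with hWdef
  have hW : 0 < W := Finset.sum_pos (fun i _ => hw i) hDne
  have hR' : 0 ≤ R' := (norm_nonneg _).trans (hxs 0)
  have hR : 0 ≤ R := (norm_nonneg _).trans (hx 0)
  obtain ⟨i₀, hi₀⟩ := hDne
  have hone : 1 ≤ R' * ‖g‖ := (hD i₀ hi₀).trans ((xs i₀).le_of_opNorm_le (hxs i₀) g)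
  have hg : 0 < ‖g‖ := by
    by_contra hg
    have := mul_nonpos_of_nonneg_of_nonpos hR' (not_lt.1 hg)
    linarith
  -- If weights above `W` occur arbitrarily far out in `T`, one basis vector suffices, its norm
  -- being controlled through `1 ≤ R' * ‖g‖`.
  by_cases hsmall : ∃ K, ∀ i ∈ T, K ≤ i → w i ≤ W
  swap
  · push Not at hsmall
    obtain ⟨i, hiT, hiN, hi⟩ := hsmall N
    refine ⟨{i}, Finset.singleton_nonempty i, by simpa using ⟨hiT, hiN⟩, by simpa using hi.le,
      fun _ => 1, fun _ _ => norm_one, ?_⟩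
    rw [Finset.sum_singleton, one_smul]
    calc ‖x i‖ ≤ R * (R' * ‖g‖) := (hx i).trans (le_mul_of_one_le_right hR hone)
      _ = R * R' * ‖g‖ := by ring
      _ ≤ _ := mul_le_mul_of_nonneg_right (le_max_left _ _) hg.le
  obtain ⟨K, hK⟩ := hsmall
  obtain ⟨N₀, hN₀⟩ := h.exists_forall_norm_coord_lt hxs g (η := s ^ 2 / 20) (by positivity)
  set t : ℝ := 9 / 10 * s ^ 2 with ht
  have ht0 : 0 < t := by positivity
  have hblock : ∀ n : ℕ, ∃ B : Finset ℕ, (B : Set ℕ) ⊆ T ∩ Set.Ici (n + N + N₀) ∧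
      W / 2 ≤ ∑ i ∈ B, w i ∧ ∃ y, supp xs y ⊆ Finset.range N₀ ∧
        ‖g + (t : 𝕜) • ∑ i ∈ B, x i - y‖ ≤ C * ‖g‖ := by
    intro n
    obtain ⟨B, hB, hB1, hB2⟩ := exists_block hT hδ hTδ hW hK (n + N + N₀)
    exact ⟨B, hB, hB1, hsg.exists_approx h hxs hs hs1 hD ⟨i₀, hi₀⟩ hN₀
      (fun i hi => le_trans (Nat.le_add_left _ _) (hB hi).2)
      ((wMeasure_coe_le_wMeasure_coe hw).2 hB2)⟩
  choose B hB hBW y hyN hy using hblock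
  have hcompact : IsCompact ((fun c : Finset.range N₀ → 𝕜 => ∑ i, c i • x i) ''
      Metric.closedBall 0 (R' * ((1 + C) * ‖g‖))) :=
    (isCompact_closedBall _ _).image (by fun_prop)
  have hymem : ∀ n, y n ∈ ((fun c : Finset.range N₀ → 𝕜 => ∑ i, c i • x i) ''
      Metric.closedBall 0 (R' * ((1 + C) * ‖g‖))) := by
    intro n
    refine ⟨fun i => xs i (y n), ?_, ?_⟩
    · rw [mem_closedBall_zero_iff, pi_norm_le_iff_of_nonneg (by positivity)]
      intro i
      have hiB : (i : ℕ) ∉ B n := fun hi => by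
        have h1 : n + N + N₀ ≤ (i : ℕ) := (hB n hi).2
        have h2 := Finset.mem_range.1 i.2
        omega
      -- The block has no coordinate at `i < N₀`, so this coordinate of `y n` is read off a vector
      -- of norm at most `(1 + C) * ‖g‖`, uniformly in `n`.
      have h1 : xs i (y n) = xs i (g - (g + (t : 𝕜) • ∑ i ∈ B n, x i - y n)) := by
        have : xs i (∑ i ∈ B n, x i) = 0 := by
          have := h.coord_sum (B n) (fun _ => 1) i
          rw [if_neg hiB] at this
          simpa using this
        simp [this]
      rw [h1]
      refine ((xs i).le_of_opNorm_le (hxs i) _).trans (mul_le_mul_of_nonneg_left ?_ hR')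
      refine (norm_sub_le _ _).trans ?_
      linarith [hy n]
    · simp only
      rw [Finset.sum_coe_sort (Finset.range N₀) fun i => xs i (y n) • x i]
      exact (h.eq_proj (hyN n)).symm
  obtain ⟨a, -, σ, hσ, hlim⟩ := hcompact.tendsto_subseq hymem
  obtain ⟨n₁, hn₁⟩ := Metric.tendsto_atTop.1 hlim (C * ‖g‖ / 10) (by positivity)
  -- Far enough for the approximants to be close and for the second block to start beyond the first.
  set n₂ := max n₁ ((B (σ n₁)).sup id + 1) with hn₂
  have hdist : ‖y (σ n₁) - y (σ n₂)‖ ≤ C * ‖g‖ / 5 := by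
    have h1 := hn₁ n₁ le_rfl
    have h2 := hn₁ n₂ (le_max_left _ _)
    rw [← dist_eq_norm]
    have := dist_triangle_right (y (σ n₁)) (y (σ n₂)) a
    simp only [Function.comp_apply] at h1 h2
    linarith
  have hdisj : Disjoint (B (σ n₁)) (B (σ n₂)) := by
    rw [Finset.disjoint_left]
    intro i hi hi'
    have h1 : i ≤ (B (σ n₁)).sup id := Finset.le_sup (f := id) hi
    have h2 : σ n₂ + N + N₀ ≤ i := (hB _ hi').2
    have h3 := hσ.id_le n₂
    simp only [id] at h3
    have h4 := le_max_right n₁ ((B (σ n₁)).sup id + 1)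
    omega
  have hfar : ∀ n, (B n : Set ℕ) ⊆ T ∩ Set.Ici N := fun n i hi =>
    ⟨(hB n hi).1, Set.mem_Ici.2 (le_trans (by omega) (Set.mem_Ici.1 (hB n hi).2))⟩
  have hne : (B (σ n₁)).Nonempty := by
    rw [Finset.nonempty_iff_ne_empty]
    intro hempty
    have := hBW (σ n₁)
    rw [hempty, Finset.sum_empty] at this
    linarith
  refine ⟨B (σ n₁) ∪ B (σ n₂), hne.mono Finset.subset_union_left, ?_, ?_,
    fun i => if i ∈ B (σ n₁) then 1 else -1, fun i _ => by dsimp only; split_ifs <;> simp, ?_⟩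
  · rw [Finset.coe_union]
    exact Set.union_subset (hfar _) (hfar _)
  · rw [Finset.sum_union hdisj]
    linarith [hBW (σ n₁), hBW (σ n₂)]
  · have hsum : ∑ i ∈ B (σ n₁) ∪ B (σ n₂), (if i ∈ B (σ n₁) then (1 : 𝕜) else -1) • x i =
        ∑ i ∈ B (σ n₁), x i - ∑ i ∈ B (σ n₂), x i := by
      rw [Finset.sum_union hdisj, sub_eq_add_neg, ← Finset.sum_neg_distrib]
      congr 1
      · exact Finset.sum_congr rfl fun i hi => by rw [if_pos hi, one_smul]
      · exact Finset.sum_congr rfl fun i hi => by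
          rw [if_neg (Finset.disjoint_right.1 hdisj hi), neg_one_smul]
    rw [hsum]
    have h1 : (t : 𝕜) • (∑ i ∈ B (σ n₁), x i - ∑ i ∈ B (σ n₂), x i) =
        (g + (t : 𝕜) • ∑ i ∈ B (σ n₁), x i - y (σ n₁)) -
          (g + (t : 𝕜) • ∑ i ∈ B (σ n₂), x i - y (σ n₂)) + (y (σ n₁) - y (σ n₂)) := by
      rw [smul_sub]; abel
    -- Two approximation errors of `C * ‖g‖` plus the gap `C * ‖g‖ / 5`. Weakening 11/5 to 9/4 and
    -- dividing by `t = 9 / 10 * s ^ 2` yields the factor 5/2.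
    have h2 : t * ‖∑ i ∈ B (σ n₁), x i - ∑ i ∈ B (σ n₂), x i‖ ≤ 11 / 5 * (C * ‖g‖) := by
      have h3 := congrArg norm h1
      rw [norm_smul, RCLike.norm_ofReal, abs_of_pos ht0] at h3
      rw [h3]
      refine (norm_add_le _ _).trans ?_
      have := norm_sub_le (g + (t : 𝕜) • ∑ i ∈ B (σ n₁), x i - y (σ n₁))
        (g + (t : 𝕜) • ∑ i ∈ B (σ n₂), x i - y (σ n₂))
      linarith [hy (σ n₁), hy (σ n₂)]
    refine le_trans ?_ (mul_le_mul_of_nonneg_right (le_max_right _ _) hg.le)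
    have h3 : 5 / 2 * C * (s ^ 2)⁻¹ * ‖g‖ = (9 / 4 * (C * ‖g‖)) / t := by
      rw [ht]; field_simp; ring
    rw [h3, le_div_iff₀ ht0, mul_comm]
    have : 0 < C * ‖g‖ := by positivity
    linarith

end SemiGreedy

/-! ### Norm estimates at a fixed separation level, and vectors of infinite support -/

section Estimates

variable {𝕜 : Type*} [RCLike 𝕜] {X : Type*} [NormedAddCommGroup X] [NormedSpace 𝕜 X]
  {x : ℕ → X} {xs : ℕ → StrongDual 𝕜 X} {w : ℕ → ℝ} {s C R R' : ℝ}

/-- The whole space is separable, so one subsequence serves all vectors; applying separation to the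
line through `v` makes only `N` depend on `v`. -/
theorem IsMarkushevichBasis.exists_separating_set (h : IsMarkushevichBasis 𝕜 x xs) {φ : ℕ → ℕ}
    (hφ : StrictMono φ) {M : ℝ} (hM : HasFDSPWith 𝕜 (x ∘ φ) M) {ε : ℝ} (hε : 0 < ε) :
    ∃ T : Set ℕ, T.Infinite ∧ T ⊆ Set.range φ ∧
      ∀ v : X, ∃ N, ∀ z ∈ Submodule.span 𝕜 (x '' (T ∩ Set.Ici N)), ‖v‖ ≤ (M + ε) * ‖v + z‖ := by
  have hsep : TopologicalSpace.IsSeparable ((⊤ : Submodule 𝕜 X) : Set X) := by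
    rw [← h.fundamental, Submodule.topologicalClosure_coe]
    exact (Set.countable_range x).isSeparable.span.closure
  obtain ⟨ψ, hψ, -, hF⟩ := hM.2 ⊤ hsep ε hε
  refine ⟨Set.range (φ ∘ ψ), Set.infinite_range_of_injective (hφ.comp hψ).injective,
    Set.range_comp_subset_range _ _, fun v => ?_⟩
  obtain ⟨j, hj⟩ := hF (Submodule.span 𝕜 {v}) le_top inferInstance
  refine ⟨φ (ψ j) + 1, fun z hz => hj v (Submodule.mem_span_singleton_self v) z ?_⟩
  refine Submodule.le_topologicalClosure _ (Submodule.span_mono ?_ hz)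
  rintro _ ⟨_, ⟨⟨k, rfl⟩, hk⟩, rfl⟩
  exact ⟨k, (hφ.comp hψ).lt_iff_lt.1 (Nat.lt_of_succ_le hk), rfl⟩

theorem le_mul_of_forall_pos {a b M : ℝ} (h : ∀ ε > 0, a ≤ b * (M + ε)) : a ≤ b * M := by
  have hlim : Tendsto (fun ε : ℝ => b * (M + ε)) (𝓝[>] 0) (𝓝 (b * M)) := by
    have : Continuous fun ε : ℝ => b * (M + ε) := by fun_prop
    simpa using (this.tendsto 0).mono_left nhdsWithin_le_nhds
  exact ge_of_tendsto hlim (eventually_mem_nhdsWithin.mono fun ε hε => h ε hε)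

theorem IsWeakSemiGreedy.norm_sum_le_of_separating (hsg : IsWeakSemiGreedy xs w s C)
    (h : IsMarkushevichBasis 𝕜 x xs) (hx : ∀ i, ‖x i‖ ≤ R) (hxs : ∀ i, ‖xs i‖ ≤ R')
    (hw : ∀ i, 0 < w i) (hC : 0 < C) (hs : 0 < s) (hs1 : s ≤ 1) {T : Set ℕ} (hT : T.Infinite)
    {δ : ℝ} (hδ : 0 < δ) (hTδ : ∀ i ∈ T, δ ≤ w i) {M : ℝ} (hM : 0 ≤ M)
    (hsep : ∀ v : X, ∃ N, ∀ z ∈ Submodule.span 𝕜 (x '' (T ∩ Set.Ici N)), ‖v‖ ≤ M * ‖v + z‖)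
    {v : X} {A D : Finset ℕ} (hD : ∀ i ∈ D, 1 ≤ ‖xs i v‖) (hAD : ∑ i ∈ A, w i ≤ ∑ i ∈ D, w i)
    {ε : ℕ → 𝕜} (hε : ∀ i ∈ A, ‖ε i‖ = 1) :
    ‖∑ i ∈ A, ε i • x i‖ ≤ 2 * s⁻¹ * C * max (R * R') (2 * (s ^ 2)⁻¹ * C) * ‖v‖ * M := by
  have hR : 0 ≤ R := (norm_nonneg _).trans (hx 0)
  have hR' : 0 ≤ R' := (norm_nonneg _).trans (hxs 0)
  rcases A.eq_empty_or_nonempty with rfl | hA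
  · rw [Finset.sum_empty, norm_zero]
    positivity
  have hDne : D.Nonempty := by
    rw [Finset.nonempty_iff_ne_empty]
    rintro rfl
    rw [Finset.sum_empty] at hAD
    exact absurd (Finset.sum_pos (fun i _ => hw i) hA) (not_lt.2 hAD)
  set u := ∑ i ∈ A, ε i • x i with hu
  have hsupp : supp xs u ⊆ A := h.supp_sum_subset A ε
  obtain ⟨N, hN⟩ := hsg.exists_norm_le_of_far h hxs hs hM (hsep u) zero_lt_one (fun i => by
    rw [hu, h.coord_sum]
    split_ifs with hi
    · exact (hε i hi).le
    · simp)
  obtain ⟨B, hBne, hB, hBw, ε', hε', hb⟩ := hsg.exists_far_unimodular h hx hxs hw hC hs hs1 hT hδ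
    hTδ hD hDne N
  -- The competitor `z = u` cancels `u`, leaving only the far block, which is bounded by `‖v‖`.
  have h1 := hN B hBne hB ε' hε' u (A.finite_toSet.subset hsupp)
    ((wMeasure_mono hsupp).trans ((wMeasure_coe_le_wMeasure_coe hw).2 (hAD.trans hBw)))
  rw [add_sub_cancel_left, norm_smul, RCLike.norm_ofReal, abs_of_nonneg (by positivity)] at h1
  have h2 : 6 / 5 * max (R * R') (5 / 2 * C * (s ^ 2)⁻¹) ≤
      2 * max (R * R') (2 * (s ^ 2)⁻¹ * C) := by
    have h3 := le_max_left (R * R') (2 * (s ^ 2)⁻¹ * C)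
    have h4 := le_max_right (R * R') (2 * (s ^ 2)⁻¹ * C)
    have h5 : 0 ≤ R * R' := by positivity
    have h6 : 0 ≤ (s ^ 2)⁻¹ * C := by positivity
    rcases max_cases (R * R') (5 / 2 * C * (s ^ 2)⁻¹) with ⟨h7, -⟩ | ⟨h7, -⟩ <;> rw [h7] <;>
      linarith
  calc ‖u‖ ≤ M * (C * (6 / 5 * 1 / s * ‖∑ i ∈ B, ε' i • x i‖)) := h1
    _ ≤ M * (C * (6 / 5 * 1 / s * (max (R * R') (5 / 2 * C * (s ^ 2)⁻¹) * ‖v‖))) := by gcongr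
    _ = M * C * s⁻¹ * ‖v‖ * (6 / 5 * max (R * R') (5 / 2 * C * (s ^ 2)⁻¹)) := by ring
    _ ≤ M * C * s⁻¹ * ‖v‖ * (2 * max (R * R') (2 * (s ^ 2)⁻¹ * C)) := by gcongr
    _ = _ := by ring

theorem IsWeakSemiGreedy.norm_sub_proj_le_of_separating (hsg : IsWeakSemiGreedy xs w s C)
    (h : IsMarkushevichBasis 𝕜 x xs) (hx : ∀ i, ‖x i‖ ≤ R) (hxs : ∀ i, ‖xs i‖ ≤ R')
    (hw : ∀ i, 0 < w i) (hC : 0 < C) (hs : 0 < s) (hs1 : s ≤ 1) {T : Set ℕ} (hT : T.Infinite)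
    {δ : ℝ} (hδ : 0 < δ) (hTδ : ∀ i ∈ T, δ ≤ w i) {M : ℝ} (hM : 0 ≤ M)
    (hsep : ∀ v : X, ∃ N, ∀ z ∈ Submodule.span 𝕜 (x '' (T ∩ Set.Ici N)), ‖v‖ ≤ M * ‖v + z‖)
    {v y : X} {A : Finset ℕ} (hAne : A.Nonempty) {t : ℝ} (ht : 0 < t)
    (hA : ∀ i ∈ A, ∀ j ∉ A, t * ‖xs j v‖ ≤ ‖xs i v‖) (hyfin : (supp xs y).Finite)
    (hyA : wMeasure w (supp xs y) ≤ wMeasure w A) (hdisj : Disjoint (supp xs y) A) :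
    ‖v - proj x xs A v‖ ≤ C *
      max (1 + 8 * t⁻¹ * s⁻¹ * R * R') (1 + 6 * C * t⁻¹ * (s ^ 3)⁻¹) * ‖v - y‖ * M := by
  classical
  have hR : 0 ≤ R := (norm_nonneg _).trans (hx 0)
  have hR' : 0 ≤ R' := (norm_nonneg _).trans (hxs 0)
  obtain ⟨i₀, hi₀, hmin⟩ := A.exists_min_image (fun i => ‖xs i v‖) hAne
  set a := ‖xs i₀ v‖ with ha
  rcases (norm_nonneg (xs i₀ v)).eq_or_lt with ha0 | ha0
  · have hsupp : supp xs v ⊆ A := by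
      intro j hj
      by_contra hjA
      have h1 := hA i₀ hi₀ j hjA
      rw [← ha0] at h1
      exact hj (norm_le_zero_iff.1 (nonpos_of_mul_nonpos_right h1 ht))
    rw [← h.eq_proj hsupp, sub_self, norm_zero]
    positivity
  rw [← ha] at ha0
  have hyS : (hyfin.toFinset : Set ℕ) = supp xs y := hyfin.coe_toFinset
  have hyzero : ∀ i ∈ A, xs i y = 0 := fun i hi => by
    by_contra hne
    exact Set.disjoint_left.1 hdisj hne hi
  have hcoord : ∀ j, xs j (v - proj x xs A v) = if j ∈ A then 0 else xs j v := fun j => by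
    rw [map_sub, proj, h.coord_sum]
    split_ifs <;> simp
  obtain ⟨N, hN⟩ := hsg.exists_norm_le_of_far h hxs hs hM (hsep (v - proj x xs A v))
    (α := a / t) (by positivity) (fun j => by
      rw [hcoord]
      split_ifs with hj
      · rw [norm_zero]; positivity
      · rw [le_div_iff₀ ht, mul_comm]
        exact hA i₀ hi₀ j hj)
  -- Since `y` vanishes on `A`, the vector `v - y` keeps the large coordinates of `v` there; this is
  -- why the block norms are bounded by `‖v - y‖`.
  have hD : ∀ i ∈ A, 1 ≤ ‖xs i ((a : 𝕜)⁻¹ • (v - y))‖ := fun i hi => by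
    rw [map_smul, map_sub, hyzero i hi, sub_zero, norm_smul, norm_inv, RCLike.norm_ofReal,
      abs_of_pos ha0, le_inv_mul_iff₀ ha0, mul_one]
    exact hmin i hi
  obtain ⟨B₁, hB₁ne, hB₁, hB₁w, ε₁, hε₁, hb₁⟩ := hsg.exists_far_unimodular h hx hxs hw hC hs hs1
    hT hδ hTδ hD hAne N
  -- Two disjoint blocks are needed: the competitor `y - P_A v` may have weight up to twice that of
  -- `A`.
  obtain ⟨B₂, hB₂ne, hB₂, hB₂w, ε₂, hε₂, hb₂⟩ := hsg.exists_far_unimodular h hx hxs hw hC hs hs1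
    hT hδ hTδ hD hAne (N + (B₁.sup id + 1))
  have hBdisj : Disjoint B₁ B₂ := by
    rw [Finset.disjoint_left]
    intro i hi hi'
    have h1 : i ≤ B₁.sup id := Finset.le_sup (f := id) hi
    have h2 : N + (B₁.sup id + 1) ≤ i := (hB₂ hi').2
    omega
  set ε : ℕ → 𝕜 := fun i => if i ∈ B₁ then ε₁ i else ε₂ i with hε
  have hsum : ∑ i ∈ B₁ ∪ B₂, ε i • x i = ∑ i ∈ B₁, ε₁ i • x i + ∑ i ∈ B₂, ε₂ i • x i := by
    rw [Finset.sum_union hBdisj]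
    congr 1
    · exact Finset.sum_congr rfl fun i hi => by rw [hε]; simp only [if_pos hi]
    · exact Finset.sum_congr rfl fun i hi => by
        rw [hε]; simp only [if_neg (Finset.disjoint_right.1 hBdisj hi)]
  have hzsupp : supp xs (y - proj x xs A v) ⊆ (hyfin.toFinset ∪ A : Finset ℕ) := by
    intro j hj
    by_contra hjn
    rw [Finset.mem_coe, Finset.mem_union, not_or, Set.Finite.mem_toFinset] at hjn
    refine hj ?_
    rw [map_sub, proj, h.coord_sum, if_neg hjn.2, sub_zero]
    by_contra hne
    exact hjn.1 hne
  have h1 := hN (B₁ ∪ B₂) (hB₁ne.mono Finset.subset_union_left) (by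
      rw [Finset.coe_union]
      exact Set.union_subset hB₁ (hB₂.trans (Set.inter_subset_inter_right _
        (Set.Ici_subset_Ici.2 (Nat.le_add_right _ _))))) ε (fun i hi => by
      rw [hε]
      dsimp only
      split_ifs with hi₁
      · exact hε₁ i hi₁
      · exact hε₂ i ((Finset.mem_union.1 hi).resolve_left hi₁)) (y - proj x xs A v)
    ((Finset.finite_toSet _).subset hzsupp) ((wMeasure_mono hzsupp).trans (by
      rw [wMeasure_coe_le_wMeasure_coe hw, Finset.sum_union hBdisj]
      rw [← hyS, wMeasure_coe_le_wMeasure_coe hw] at hyA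
      have h2 : ∑ i ∈ hyfin.toFinset ∪ A, w i ≤ ∑ i ∈ hyfin.toFinset, w i + ∑ i ∈ A, w i := by
        rw [← Finset.sum_union_inter]
        exact le_add_of_nonneg_right (Finset.sum_nonneg fun i _ => (hw i).le)
      linarith))
  set m := max (R * R') (5 / 2 * C * (s ^ 2)⁻¹) with hm
  set τ : ℝ := 6 / 5 * (a / t) / s with hτ
  have hτ0 : 0 ≤ τ := by positivity
  rw [norm_smul, norm_inv, RCLike.norm_ofReal, abs_of_pos ha0] at hb₁ hb₂
  have h3 : ‖v - proj x xs A v + (τ : 𝕜) • ∑ i ∈ B₁ ∪ B₂, ε i • x i - (y - proj x xs A v)‖ ≤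
      ‖v - y‖ + τ * (2 * (m * (a⁻¹ * ‖v - y‖))) := by
    rw [show v - proj x xs A v + (τ : 𝕜) • ∑ i ∈ B₁ ∪ B₂, ε i • x i - (y - proj x xs A v) =
      (v - y) + (τ : 𝕜) • ∑ i ∈ B₁ ∪ B₂, ε i • x i by abel]
    refine (norm_add_le _ _).trans (add_le_add_right ?_ _)
    rw [norm_smul, RCLike.norm_ofReal, abs_of_nonneg hτ0, hsum]
    refine mul_le_mul_of_nonneg_left ((norm_add_le _ _).trans ?_) hτ0
    linarith
  have h4 : τ * (2 * (m * (a⁻¹ * ‖v - y‖))) = 12 / 5 * t⁻¹ * s⁻¹ * m * ‖v - y‖ := by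
    rw [hτ]
    field_simp
    ring
  -- Here 12/5 is twice the 6/5 in `τ`; multiplied by 5/2 it gives exactly the 6 in the second term,
  -- while the 8 in the first leaves room.
  have h5 : 1 + 12 / 5 * t⁻¹ * s⁻¹ * m ≤
      max (1 + 8 * t⁻¹ * s⁻¹ * R * R') (1 + 6 * C * t⁻¹ * (s ^ 3)⁻¹) := by
    rcases max_cases (R * R') (5 / 2 * C * (s ^ 2)⁻¹) with ⟨h7, -⟩ | ⟨h7, -⟩
    · refine le_trans ?_ (le_max_left _ _)
      rw [hm, h7]
      have : 0 ≤ t⁻¹ * s⁻¹ * (R * R') := by positivity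
      linarith
    · refine le_trans (le_of_eq ?_) (le_max_right _ _)
      rw [hm, h7]
      field_simp
      ring
  calc ‖v - proj x xs A v‖
      ≤ M * (C * (‖v - y‖ + τ * (2 * (m * (a⁻¹ * ‖v - y‖))))) :=
        h1.trans (by gcongr)
    _ = M * C * ‖v - y‖ * (1 + 12 / 5 * t⁻¹ * s⁻¹ * m) := by rw [h4]; ring
    _ ≤ M * C * ‖v - y‖ * max (1 + 8 * t⁻¹ * s⁻¹ * R * R') (1 + 6 * C * t⁻¹ * (s ^ 3)⁻¹) := by
        gcongr
    _ = _ := by ring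

/-- A norm bound for all unimodular combinations extends to bounded coefficients. -/
theorem norm_sum_smul_le_of_unimodular {F : Finset ℕ} {K η : ℝ}
    (hK : ∀ ε : ℕ → 𝕜, (∀ i ∈ F, ‖ε i‖ = 1) → ‖∑ i ∈ F, ε i • x i‖ ≤ K) {c : ℕ → 𝕜}
    (hη : 0 ≤ η) (hc : ∀ i ∈ F, ‖c i‖ ≤ η) : ‖∑ i ∈ F, c i • x i‖ ≤ η * K := by
  classical
  obtain ⟨f, hf, hfv⟩ := exists_dual_vector'' 𝕜 (∑ i ∈ F, c i • x i)
  have h1 : ‖∑ i ∈ F, c i • x i‖ ≤ η * ∑ i ∈ F, ‖f (x i)‖ := by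
    have h2 : ‖f (∑ i ∈ F, c i • x i)‖ = ‖∑ i ∈ F, c i • x i‖ := by
      rw [hfv, RCLike.norm_ofReal, abs_norm]
    rw [← h2, map_sum, Finset.mul_sum]
    refine (norm_sum_le _ _).trans (Finset.sum_le_sum fun i hi => ?_)
    rw [map_smul, norm_smul]
    exact mul_le_mul_of_nonneg_right (hc i hi) (norm_nonneg _)
  -- These phases align all `f (x i)`, so one unimodular sum bounds the sum of their moduli.
  set ε : ℕ → 𝕜 := fun i => if f (x i) = 0 then 1 else (‖f (x i)‖ : 𝕜) / f (x i) with hε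
  have hε1 : ∀ i, ‖ε i‖ = 1 := fun i => by
    rw [hε]
    dsimp only
    split_ifs with hi
    · exact norm_one
    · rw [norm_div, RCLike.norm_ofReal, abs_norm, div_self (norm_ne_zero_iff.2 hi)]
  have hε2 : ∀ i, ε i * f (x i) = (‖f (x i)‖ : 𝕜) := fun i => by
    rw [hε]
    dsimp only
    split_ifs with hi
    · rw [hi]; simp
    · rw [div_mul_cancel₀ _ hi]
  have h3 : ∑ i ∈ F, ‖f (x i)‖ ≤ K := by
    have h4 : f (∑ i ∈ F, ε i • x i) = ((∑ i ∈ F, ‖f (x i)‖ : ℝ) : 𝕜) := by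
      rw [map_sum, RCLike.ofReal_sum]
      exact Finset.sum_congr rfl fun i _ => by rw [map_smul, smul_eq_mul, hε2]
    have h5 := f.le_of_opNorm_le hf (∑ i ∈ F, ε i • x i)
    rw [h4, RCLike.norm_ofReal, one_mul] at h5
    exact (le_abs_self _).trans (h5.trans (hK ε fun i _ => hε1 i))
  exact h1.trans (mul_le_mul_of_nonneg_left h3 hη)

/-- If all unimodular sums over finite subsets of the support of `y` are uniformly bounded, then
`y` is the limit of its partial sums. -/
theorem IsMarkushevichBasis.tendsto_proj_range [CompleteSpace X] (h : IsMarkushevichBasis 𝕜 x xs)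
    (hxs : ∀ i, ‖xs i‖ ≤ R') {y : X} {K : ℝ} (hK : ∀ F : Finset ℕ, (F : Set ℕ) ⊆ supp xs y →
      ∀ ε : ℕ → 𝕜, (∀ i ∈ F, ‖ε i‖ = 1) → ‖∑ i ∈ F, ε i • x i‖ ≤ K) :
    Tendsto (fun n => proj x xs (Finset.range n) y) atTop (𝓝 y) := by
  classical
  have hK0 : 0 ≤ K := by simpa using hK ∅ (by simp) (fun _ => 1) (by simp)
  have hcauchy : CauchySeq fun n => proj x xs (Finset.range n) y := by
    rw [Metric.cauchySeq_iff']
    intro δ hδ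
    obtain ⟨N, hN⟩ := h.exists_forall_norm_coord_lt hxs y (η := δ / (K + 1)) (by positivity)
    refine ⟨N, fun n hn => ?_⟩
    rw [dist_eq_norm, proj, proj, ← Finset.sum_Ico_eq_sub _ hn,
      ← Finset.sum_filter_of_ne (p := fun i => xs i y ≠ 0)
        (fun i _ hne h0 => hne (by rw [h0, zero_smul]))]
    refine (norm_sum_smul_le_of_unimodular (hK _ ?_) (η := δ / (K + 1)) (by positivity)
      fun i hi => (hN i ?_).le).trans_lt ?_
    · intro i hi
      exact (Finset.mem_filter.1 hi).2
    · exact (Finset.mem_Ico.1 (Finset.mem_filter.1 hi).1).1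
    · rw [div_mul_eq_mul_div, div_lt_iff₀ (by positivity)]
      exact mul_lt_mul_of_pos_left (by linarith) hδ
  obtain ⟨y', hy'⟩ := cauchySeq_tendsto_of_complete hcauchy
  have hyy' : y = y' := by
    rw [← sub_eq_zero]
    refine h.eq_zero fun j => ?_
    have h1 : Tendsto (fun n => xs j (proj x xs (Finset.range n) y)) atTop (𝓝 (xs j y')) :=
      ((xs j).continuous.tendsto y').comp hy'
    have h2 : Tendsto (fun n => xs j (proj x xs (Finset.range n) y)) atTop (𝓝 (xs j y)) := by
      refine tendsto_const_nhds.congr' ?_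
      filter_upwards [eventually_gt_atTop j] with n hn
      rw [proj, h.coord_sum, if_pos (Finset.mem_range.2 hn)]
    rw [map_sub, tendsto_nhds_unique h2 h1, sub_self]
  rwa [← hyy'] at hy'

/-- Outside a finite set `t`, finite subsets of `S` weigh less than index 0, so superdemocracy
compares their sums with `x 0`. The part in `t` is bounded by the triangle inequality. -/
theorem IsSuperdemocratic.exists_bound_of_wMeasure_ne_top {K : ℝ}
    (hsd : IsSuperdemocratic 𝕜 x w K) (hK : 0 ≤ K) (hx : ∀ i, ‖x i‖ ≤ R) (hw : ∀ i, 0 < w i)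
    {S : Set ℕ} (hS : wMeasure w S ≠ ⊤) :
    ∃ K', ∀ F : Finset ℕ, (F : Set ℕ) ⊆ S → ∀ ε : ℕ → 𝕜, (∀ i ∈ F, ‖ε i‖ = 1) →
      ‖∑ i ∈ F, ε i • x i‖ ≤ K' := by
  classical
  have hR : 0 ≤ R := (norm_nonneg _).trans (hx 0)
  rw [wMeasure, tsum_subtype S fun i => ENNReal.ofReal (w i)] at hS
  obtain ⟨t, ht⟩ := summable_iff_vanishing_norm.1 (ENNReal.summable_toReal hS) (w 0) (hw 0)
  refine ⟨t.card * R + K * R, fun F hF ε hε => ?_⟩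
  have h1 : ∑ i ∈ F \ t, w i ≤ w 0 := by
    have h2 := ht (F \ t) Finset.sdiff_disjoint
    rw [Finset.sum_congr rfl fun i hi => by
      rw [Set.indicator_of_mem (hF (Finset.mem_sdiff.1 hi).1), ENNReal.toReal_ofReal (hw i).le]]
      at h2
    exact (le_abs_self _).trans h2.le
  have h2 : ‖∑ i ∈ F \ t, ε i • x i‖ ≤ K * R := by
    have h3 := hsd (F \ t) {0} (by
      rw [wMeasure_coe_le_wMeasure_coe hw, Finset.sum_singleton]; exact h1) ε (fun _ => 1)
      (fun i hi => hε i (Finset.mem_sdiff.1 hi).1) (fun _ _ => norm_one)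
    rw [Finset.sum_singleton, one_smul] at h3
    exact h3.trans (mul_le_mul_of_nonneg_left (hx 0) hK)
  have h3 : ‖∑ i ∈ F ∩ t, ε i • x i‖ ≤ t.card * R := by
    refine (norm_sum_le _ _).trans ?_
    refine (Finset.sum_le_card_nsmul _ _ R fun i hi => ?_).trans ?_
    · rw [norm_smul, hε i (Finset.mem_inter.1 hi).1, one_mul]; exact hx i
    · rw [nsmul_eq_mul]
      exact mul_le_mul_of_nonneg_right
        (Nat.cast_le.2 (Finset.card_le_card Finset.inter_subset_right)) hR
  rw [← Finset.sum_inter_add_sum_sdiff F t]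
  exact (norm_add_le _ _).trans (add_le_add h3 h2)

end Estimates

/-! ### Distinguished greedy sets and the derived greedy-type properties -/

section AlmostGreedy

variable {𝕜 : Type*} [RCLike 𝕜] {X : Type*} [NormedAddCommGroup X] [NormedSpace 𝕜 X]
  {x : ℕ → X} {xs : ℕ → StrongDual 𝕜 X} {w : ℕ → ℝ} {s C R R' : ℝ}

theorem exists_finset_card_eq_forall_lt_or {c : ℕ → ℝ} (hc0 : ∀ i, 0 ≤ c i)
    (hc : ∀ η > 0, {i | η ≤ c i}.Finite) (m : ℕ) : ∃ A : Finset ℕ, A.card = m ∧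
      ∀ i ∈ A, ∀ j ∉ A, c j < c i ∨ (c j = c i ∧ i < j) := by
  classical
  induction m with
  | zero => exact ⟨∅, rfl, by simp⟩
  | succ m ih =>
    obtain ⟨A, hcard, hA⟩ := ih
    obtain ⟨k, hkA, hk⟩ : ∃ k ∉ A, ∀ j ∉ A, j ≠ k → c j < c k ∨ (c j = c k ∧ k < j) := by
      by_cases hpos : ∃ j ∉ A, 0 < c j
      · obtain ⟨j, hjA, hj⟩ := hpos
        have hmem : ∀ i, i ∈ (hc _ hj).toFinset \ A ↔ c j ≤ c i ∧ i ∉ A := fun i => by simp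
        obtain ⟨k, hkS, hk⟩ := ((hc _ hj).toFinset \ A).exists_max_image
          -- The order dual makes the lexicographic maximum prefer the smallest index among ties.
          (fun i => toLex (c i, OrderDual.toDual i)) ⟨j, (hmem j).2 ⟨le_rfl, hjA⟩⟩
        rw [hmem] at hkS
        refine ⟨k, hkS.2, fun i hiA hik => ?_⟩
        by_cases hi : c j ≤ c i
        · have h1 := hk i ((hmem i).2 ⟨hi, hiA⟩)
          rw [Prod.Lex.toLex_le_toLex] at h1
          exact h1.imp id fun h2 =>
            ⟨h2.1, lt_of_le_of_ne (OrderDual.toDual_le_toDual.1 h2.2) hik.symm⟩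
        · exact Or.inl ((not_le.1 hi).trans_le hkS.1)
      · push Not at hpos
        have hzero : ∀ j ∉ A, c j = 0 := fun j hj => le_antisymm (hpos j hj) (hc0 j)
        have hex : ∃ k, k ∉ A := Infinite.exists_notMem_finset A
        refine ⟨Nat.find hex, Nat.find_spec hex, fun j hj hjk => Or.inr ⟨?_, ?_⟩⟩
        · rw [hzero j hj, hzero _ (Nat.find_spec hex)]
        · exact lt_of_le_of_ne (Nat.find_min' hex hj) hjk.symm
    refine ⟨insert k A, by rw [Finset.card_insert_of_notMem hkA, hcard], fun i hi j hj => ?_⟩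
    rw [Finset.mem_insert, not_or] at hj
    rcases Finset.mem_insert.1 hi with rfl | hi
    · exact hk j hj.2 hj.1
    · exact hA i hi j hj.2

theorem IsMarkushevichBasis.exists_isLambda (h : IsMarkushevichBasis 𝕜 x xs)
    (hxs : ∀ i, ‖xs i‖ ≤ R') (v : X) (m : ℕ) : ∃ A, IsLambda xs v m A := by
  obtain ⟨A, hcard, hA⟩ := exists_finset_card_eq_forall_lt_or (fun i => norm_nonneg (xs i v))
    (fun η hη => h.finite_setOf_le_norm_coord hxs v hη) m
  refine ⟨A, ⟨hcard, fun i hi j hj => ?_⟩, fun B hB i hi j hj => ?_⟩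
  · rw [one_mul]
    exact (hA i hi j hj).elim le_of_lt fun h1 => h1.1.le
  · rw [Finset.mem_sdiff] at hi hj
    have h1 := hB.2 j hj.1 i hi.2
    rw [one_mul] at h1
    exact ((hA i hi.1 j hj.2).resolve_left (not_lt.2 h1)).2

/-- For `x 0 + x 1` and `m = 1` the approximant is its own competitor, and its error is nonzero
because its support has at most one index. -/
theorem IsWeakSemiGreedy.one_le (hsg : IsWeakSemiGreedy xs w s C)
    (h : IsMarkushevichBasis 𝕜 x xs) : 1 ≤ C := by
  obtain ⟨A, ⟨hcard, -⟩, y, hyA, hy⟩ := hsg (∑ i ∈ {0, 1}, (1 : 𝕜) • x i) 1 le_rfl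
  obtain ⟨k, rfl⟩ := Finset.card_eq_one.1 hcard
  have h1 := hy y ((Finset.finite_toSet _).subset hyA) (wMeasure_mono hyA)
  have hne : ∑ i ∈ {0, 1}, (1 : 𝕜) • x i - y ≠ 0 := by
    obtain ⟨j, hj, hjk⟩ : ∃ j ∈ ({0, 1} : Finset ℕ), j ≠ k := by
      by_cases hk : k = 0
      · exact ⟨1, by simp, by omega⟩
      · exact ⟨0, by simp, fun h0 => hk h0.symm⟩
    intro h0
    have h2 := congrArg (xs j) h0
    have h3 : xs j y = 0 := by
      by_contra hne
      exact hjk (by simpa using hyA hne)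
    rw [map_sub, h.coord_sum, if_pos hj, h3, map_zero, sub_zero] at h2
    exact one_ne_zero h2
  exact le_of_mul_le_mul_right (by rwa [one_mul]) (norm_pos_iff.2 hne)

/-- Lebesgue type bounds for disjointly supported vectors yield almost greediness. -/
theorem isAlmostGreedy_of_disjoint (h : IsMarkushevichBasis 𝕜 x xs) (hxs : ∀ i, ‖xs i‖ ≤ R')
    (hw : ∀ i, 0 < w i) {K : ℝ} (hK1 : 1 ≤ K)
    (hK : ∀ (v : X) (m : ℕ) (A : Finset ℕ) (y : X), 1 ≤ m → IsGreedySet xs v m 1 A →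
      wMeasure w (supp xs y) ≤ wMeasure w A → Disjoint (supp xs y) (A : Set ℕ) →
      ‖v - proj x xs A v‖ ≤ K * ‖v - y‖) : IsAlmostGreedy x xs w K := by
  classical
  intro v m _
  obtain ⟨A, hA⟩ := h.exists_isLambda hxs v m
  refine ⟨A, hA, fun B hB => ?_⟩
  have hsplit : ∀ A B : Finset ℕ, proj x xs A v = proj x xs (A ∩ B) v + proj x xs (A \ B) v :=
    fun A B => (Finset.sum_inter_add_sum_sdiff A B _).symm
  have hcoord : ∀ (A : Finset ℕ) j, xs j (proj x xs A v) = if j ∈ A then xs j v else 0 :=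
    fun A j => h.coord_sum A _ j
  have hsdiff : ∑ i ∈ B \ A, w i ≤ ∑ i ∈ A \ B, w i := by
    rw [wMeasure_coe_le_wMeasure_coe hw, ← Finset.sum_inter_add_sum_sdiff A B,
      ← Finset.sum_inter_add_sum_sdiff B A, Finset.inter_comm] at hB
    linarith
  rcases (A \ B).eq_empty_or_nonempty with hemp | hne
  · have hBA : B \ A = ∅ := by
      rw [← Finset.not_nonempty_iff_eq_empty]
      intro hne
      rw [hemp, Finset.sum_empty] at hsdiff
      exact absurd (Finset.sum_pos (fun i _ => hw i) hne) (not_lt.2 hsdiff)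
    have hAB : A = B := (Finset.sdiff_eq_empty_iff_subset.1 hemp).antisymm
      (Finset.sdiff_eq_empty_iff_subset.1 hBA)
    rw [hAB]
    exact le_mul_of_one_le_left (norm_nonneg _) hK1
  have hsupp : supp xs (proj x xs (B \ A) v) ⊆ (B \ A : Finset ℕ) := h.supp_sum_subset _ _
  have hu : ∀ j, xs j (v - proj x xs (A ∩ B) v) = if j ∈ A ∩ B then 0 else xs j v := fun j => by
    rw [map_sub, hcoord]
    split_ifs <;> simp
  have hproj : proj x xs (A \ B) (v - proj x xs (A ∩ B) v) = proj x xs (A \ B) v := by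
    refine Finset.sum_congr rfl fun i hi => ?_
    rw [hu, if_neg]
    exact fun hi' => (Finset.mem_sdiff.1 hi).2 (Finset.mem_inter.1 hi').2
  -- Removing the common part `A ∩ B` makes `A \ B` greedy for what is left and disjoint from the
  -- competitor on `B \ A`; both remainders are unchanged.
  have key := hK (v - proj x xs (A ∩ B) v) (A \ B).card (A \ B) (proj x xs (B \ A) v) hne.card_pos
    ⟨rfl, fun i hi j hj => by
      rw [Finset.mem_sdiff] at hi hj
      rw [hu, hu, if_neg fun hi' => hi.2 (Finset.mem_inter.1 hi').2]
      split_ifs with hj'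
      · rw [norm_zero, mul_zero]; exact norm_nonneg _
      · refine hA.1.2 i hi.1 j fun hjA => hj' ?_
        rw [Finset.mem_inter]
        refine ⟨hjA, ?_⟩
        by_contra hjB
        exact hj ⟨hjA, hjB⟩⟩
    ((wMeasure_mono hsupp).trans ((wMeasure_coe_le_wMeasure_coe hw).2 hsdiff))
    (Set.disjoint_of_subset_left hsupp (Finset.disjoint_coe.2 disjoint_sdiff_sdiff))
  rw [hproj, sub_sub, ← hsplit, sub_sub] at key
  rw [hsplit B A, Finset.inter_comm B A]
  exact key

/-- Property (C) follows from the bound in terms of the weights of superlevel sets. -/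
theorem hasPropertyC_of_superlevel {K : ℝ} (hK0 : 0 ≤ K)
    (hK : ∀ (v : X) (A : Finset ℕ) (ε : ℕ → 𝕜), (∀ i ∈ A, ‖ε i‖ = 1) →
      wMeasure w A ≤ wMeasure w {i | 1 ≤ ‖xs i v‖} → ‖∑ i ∈ A, ε i • x i‖ ≤ K * ‖v‖) :
    HasPropertyC x xs K := by
  intro v A hA ε hε
  set a := A.inf' hA (fun i => ‖xs i v‖) with ha
  have hle : ∀ i ∈ A, a ≤ ‖xs i v‖ := fun i hi => Finset.inf'_le _ hi
  have ha0 : 0 ≤ a := (Finset.le_inf'_iff hA _).2 fun i _ => norm_nonneg _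
  rcases ha0.eq_or_lt with ha0 | ha0
  · rw [← ha0, zero_mul]
    positivity
  have h1 := hK ((a : 𝕜)⁻¹ • v) A ε hε (wMeasure_mono fun i hi => by
    rw [Set.mem_ofPred_eq, map_smul, norm_smul, norm_inv, RCLike.norm_ofReal, abs_of_pos ha0,
      le_inv_mul_iff₀ ha0, mul_one]
    exact hle i hi)
  rw [norm_smul, norm_inv, RCLike.norm_ofReal, abs_of_pos ha0, mul_left_comm,
    le_inv_mul_iff₀ ha0] at h1
  exact h1

theorem norm_sgn (a : 𝕜) : ‖sgn a‖ = 1 := by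
  rw [sgn]
  split_ifs with h
  · exact norm_one
  · rw [norm_div, RCLike.norm_ofReal, abs_norm, div_self (norm_ne_zero_iff.2 h)]

theorem HasPropertyC.isTruncationQuasiGreedy {K : ℝ} (h : HasPropertyC x xs K) :
    IsTruncationQuasiGreedy x xs K := fun v A hA =>
  h v A hA (fun i => sgn (xs i v)) fun _ _ => norm_sgn _

theorem isSuperdemocratic_of_superlevel (h : IsMarkushevichBasis 𝕜 x xs) {K : ℝ}
    (hK : ∀ (v : X) (A : Finset ℕ) (ε : ℕ → 𝕜), (∀ i ∈ A, ‖ε i‖ = 1) →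
      wMeasure w A ≤ wMeasure w {i | 1 ≤ ‖xs i v‖} → ‖∑ i ∈ A, ε i • x i‖ ≤ K * ‖v‖) :
    IsSuperdemocratic 𝕜 x w K := fun A B hAB ε ε' hε hε' =>
  hK _ A ε hε (hAB.trans (wMeasure_mono fun i hi => by
    rw [Set.mem_ofPred_eq, h.coord_sum, if_pos (Finset.mem_coe.1 hi), hε' i hi]))

end AlmostGreedy

end WeightedGreedy

/-! ### The main theorem -/

theorem mainTheorem1 {𝕜 : Type*} [RCLike 𝕜]
    {X : Type*} [NormedAddCommGroup X] [NormedSpace 𝕜 X] [CompleteSpace X]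
    (x : ℕ → X) (xs : ℕ → StrongDual 𝕜 X)
    (hbasis : WeightedGreedy.IsMarkushevichBasis 𝕜 x xs)
    (hx : BddAbove (Set.range fun i => ‖x i‖))
    (hxs : BddAbove (Set.range fun i => ‖xs i‖))
    (w : ℕ → ℝ) (hw : ∀ i, 0 < w i)
    (C s : ℝ) (hC : 0 < C) (hs : 0 < s) (hs1 : s ≤ 1)
    (hsg : WeightedGreedy.IsWeakSemiGreedy xs w s C)
    (φ : ℕ → ℕ) (hφ : StrictMono φ) (hinf : 0 < ⨅ k, w (φ k))
    (lam lam' M : ℝ) (hlam : lam = ⨆ i, ‖x i‖) (hlam' : lam' = ⨆ i, ‖xs i‖)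
    (hM : M = WeightedGreedy.fdsConstant 𝕜 (x ∘ φ)) :
    -- the separation constant exists, as a minimum
    IsLeast {M' | WeightedGreedy.HasFDSPWith 𝕜 (x ∘ φ) M'} M ∧
    -- disjoint Lebesgue-type bound for weak greedy sets
    (∀ (v : X) (m : ℕ) (t : ℝ) (A : Finset ℕ) (y : X), 1 ≤ m → 0 < t → t ≤ 1 →
      WeightedGreedy.IsGreedySet xs v m t A →
      WeightedGreedy.wMeasure w (WeightedGreedy.supp xs y) ≤ WeightedGreedy.wMeasure w A →
      Disjoint (WeightedGreedy.supp xs y) (A : Set ℕ) →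
      ‖v - WeightedGreedy.proj x xs A v‖ ≤
        C * M * max (1 + 8 * t⁻¹ * s⁻¹ * lam * lam') (1 + 6 * C * t⁻¹ * (s ^ 3)⁻¹) * ‖v - y‖) ∧
    WeightedGreedy.IsAlmostGreedy x xs w
      (C * M * max (1 + 8 * s⁻¹ * lam * lam') (1 + 6 * C * (s ^ 3)⁻¹)) ∧
    (∀ (v : X) (A : Finset ℕ) (ε : ℕ → 𝕜), (∀ i ∈ A, ‖ε i‖ = 1) →
      WeightedGreedy.wMeasure w A ≤ WeightedGreedy.wMeasure w {i | 1 ≤ ‖xs i v‖} →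
      ‖∑ i ∈ A, ε i • x i‖ ≤
        2 * s⁻¹ * C * M * max (lam * lam') (2 * (s ^ 2)⁻¹ * C) * ‖v‖) ∧
    WeightedGreedy.IsSuperdemocratic 𝕜 x w
      (2 * s⁻¹ * C * M * max (lam * lam') (2 * (s ^ 2)⁻¹ * C)) ∧
    WeightedGreedy.IsTruncationQuasiGreedy x xs
      (2 * s⁻¹ * C * M * max (lam * lam') (2 * (s ^ 2)⁻¹ * C)) ∧
    WeightedGreedy.HasPropertyC x xs
      (2 * s⁻¹ * C * M * max (lam * lam') (2 * (s ^ 2)⁻¹ * C)) := by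
  have hxR : ∀ i, ‖x i‖ ≤ lam := fun i => hlam ▸ le_ciSup hx i
  have hxsR : ∀ i, ‖xs i‖ ≤ lam' := fun i => hlam' ▸ le_ciSup hxs i
  have hlam0 : 0 ≤ lam := (norm_nonneg _).trans (hxR 0)
  have hlam0' : 0 ≤ lam' := (norm_nonneg _).trans (hxsR 0)
  have hxne : ∀ k, (x ∘ φ) k ≠ 0 := fun k h0 => by
    have h1 := hbasis.biorthogonal (φ k) (φ k)
    rw [if_pos rfl, show x (φ k) = 0 from h0, map_zero] at h1
    exact zero_ne_one h1
  have hleast : IsLeast {M' | WeightedGreedy.HasFDSPWith 𝕜 (x ∘ φ) M'} M :=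
    hM ▸ WeightedGreedy.isLeast_fdsConstant hxne (hbasis.exists_hasFDSPWith hxR hxsR hφ)
  have hM1 : 1 ≤ M := WeightedGreedy.HasFDSPWith.one_le hleast.1 hxne
  have hC1 : 1 ≤ C := hsg.one_le hbasis
  have hδ : ∀ i ∈ Set.range φ, ⨅ k, w (φ k) ≤ w i := by
    rintro _ ⟨k, rfl⟩
    exact ciInf_le ⟨0, by rintro _ ⟨j, rfl⟩; exact (hw _).le⟩ k
  have hii : ∀ (v : X) (A : Finset ℕ) (ε : ℕ → 𝕜), (∀ i ∈ A, ‖ε i‖ = 1) →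
      WeightedGreedy.wMeasure w A ≤ WeightedGreedy.wMeasure w {i | 1 ≤ ‖xs i v‖} →
      ‖∑ i ∈ A, ε i • x i‖ ≤
        2 * s⁻¹ * C * M * max (lam * lam') (2 * (s ^ 2)⁻¹ * C) * ‖v‖ := by
    intro v A ε hε hA
    have hfin := hbasis.finite_setOf_le_norm_coord hxsR v zero_lt_one
    rw [← hfin.coe_toFinset, WeightedGreedy.wMeasure_coe_le_wMeasure_coe hw] at hA
    -- The separating set `T` only achieves `M + η` and depends on `η`, but the resulting inequality
    -- does not involve `T`, so `η` can tend to 0.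
    refine (WeightedGreedy.le_mul_of_forall_pos (M := M) fun η hη => ?_).trans_eq
      (show 2 * s⁻¹ * C * max (lam * lam') (2 * (s ^ 2)⁻¹ * C) * ‖v‖ * M = _ by ring)
    obtain ⟨T, hT, hTφ, hsep⟩ := hbasis.exists_separating_set hφ hleast.1 hη
    exact hsg.norm_sum_le_of_separating hbasis hxR hxsR hw hC hs hs1 hT hinf
      (fun i hi => hδ i (hTφ hi)) (by linarith) hsep (D := hfin.toFinset)
      (fun i hi => by simpa using hi) hA hε
  have hK0 : 0 ≤ 2 * s⁻¹ * C * M * max (lam * lam') (2 * (s ^ 2)⁻¹ * C) := by positivity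
  have hsd := WeightedGreedy.isSuperdemocratic_of_superlevel hbasis hii
  have hPC := WeightedGreedy.hasPropertyC_of_superlevel hK0 hii
  have hi : ∀ (v : X) (m : ℕ) (t : ℝ) (A : Finset ℕ) (y : X), 1 ≤ m → 0 < t → t ≤ 1 →
      WeightedGreedy.IsGreedySet xs v m t A →
      WeightedGreedy.wMeasure w (WeightedGreedy.supp xs y) ≤ WeightedGreedy.wMeasure w A →
      Disjoint (WeightedGreedy.supp xs y) (A : Set ℕ) →
      ‖v - WeightedGreedy.proj x xs A v‖ ≤
        C * M * max (1 + 8 * t⁻¹ * s⁻¹ * lam * lam') (1 + 6 * C * t⁻¹ * (s ^ 3)⁻¹) *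
          ‖v - y‖ := by
    intro v m t A y hm ht _ hA hyA hdisj
    have hAne : A.Nonempty := Finset.card_pos.1 (hA.1 ▸ hm)
    have hpart : ∀ n, WeightedGreedy.supp xs (WeightedGreedy.proj x xs (Finset.range n) y) ⊆
        WeightedGreedy.supp xs y := by
      intro n j hj h0
      refine hj ?_
      rw [WeightedGreedy.proj, hbasis.coord_sum, h0, ite_self]
    have hbound : ∀ n, ‖v - WeightedGreedy.proj x xs A v‖ ≤
        C * M * max (1 + 8 * t⁻¹ * s⁻¹ * lam * lam') (1 + 6 * C * t⁻¹ * (s ^ 3)⁻¹) *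
          ‖v - WeightedGreedy.proj x xs (Finset.range n) y‖ := by
      intro n
      refine (WeightedGreedy.le_mul_of_forall_pos (M := M) fun η hη => ?_).trans_eq
        (show C * max (1 + 8 * t⁻¹ * s⁻¹ * lam * lam') (1 + 6 * C * t⁻¹ * (s ^ 3)⁻¹) *
          ‖v - WeightedGreedy.proj x xs (Finset.range n) y‖ * M = _ by ring)
      obtain ⟨T, hT, hTφ, hsep⟩ := hbasis.exists_separating_set hφ hleast.1 hη
      exact hsg.norm_sub_proj_le_of_separating hbasis hxR hxsR hw hC hs hs1 hT hinf
        (fun i hi => hδ i (hTφ hi)) (by linarith) hsep hAne ht hA.2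
        ((Finset.finite_toSet _).subset (hbasis.supp_sum_subset _ _))
        ((WeightedGreedy.wMeasure_mono (hpart n)).trans hyA)
        (Set.disjoint_of_subset_left (hpart n) hdisj)
    -- The weight of `supp y` is finite, being at most that of the finite set `A`. This gives
    -- convergence of the partial sums of `y`, and the bound passes to the limit.
    obtain ⟨K', hK'⟩ := hsd.exists_bound_of_wMeasure_ne_top hK0 hxR hw
      (S := WeightedGreedy.supp xs y) (ne_top_of_le_ne_top (by
        rw [WeightedGreedy.wMeasure_coe_finset hw]; exact ENNReal.ofReal_ne_top) hyA)
    have hlim := hbasis.tendsto_proj_range hxsR hK'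
    exact ge_of_tendsto' ((tendsto_const_nhds.sub hlim).norm.const_mul _) hbound
  refine ⟨hleast, hi, ?_, hii, hsd, hPC.isTruncationQuasiGreedy, hPC⟩
  refine WeightedGreedy.isAlmostGreedy_of_disjoint hbasis hxsR hw ?_ fun v m A y hm hA hyA hd => ?_
  · have h1 : 1 ≤ 1 + 6 * C * (s ^ 3)⁻¹ := le_add_of_nonneg_right (by positivity)
    exact one_le_mul_of_one_le_of_one_le (one_le_mul_of_one_le_of_one_le hC1 hM1)
      (h1.trans (le_max_right _ _))
  · have h1 := hi v m 1 A y hm zero_lt_one le_rfl hA hyA hd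
    rwa [inv_one, mul_one, mul_one] at h1
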